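/- Let $V$ be a vector space of finite dimension $n$ over a field of characteristic $\neq 2$, let $\xi$ be a nondegenerate symplectic (alternating) bilinear form on $V$, and let $1\le k\le n-1$. For a subspace $U$ put $U^\perp=\{v\in V:\xi(u,v)=0\text{ for all }u\in U\}$ and $\mathrm{Rad}(U)=U\cap U^\perp$. Let $(\mathbf{T\text{-}R})_j$ be the set of $j$-dimensional subspaces $U$ with $\mathrm{Rad}(U)=0$ if $j$ is even, and with $\dim\mathrm{Rad}(U)=1$ if $j$ is odd. The Grassmann space $\mathbf{P}((\mathbf{T\text{-}R}),k)$ has $(\mathbf{T\text{-}R})_k$ as its set of points, and its lines are the nonempty sets of the form $\{U\in(\mathbf{T\text{-}R})_k: H\subset U\subset B\}$ with $H\in(\mathbf{T\text{-}R})_{k-1}$, $B\in(\mathbf{T\text{-}R})_{k+1}$, $H\subset B$. Write $U\sim W$ (adjacency) if $U\ne W$ lie on a common line of this space. Let $\mathfrak P$ be the projective space whose points and lines are the $1$- and $2$-dimensional subspaces of $V$, with inclusion as incidence. A collineation of $\mathfrak P$ is an automorphism of this incidence structure; it preserves $\perp$ (is an automorphism of $(\mathfrak P,\perp)$) if points $p,q$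 satisfy $\xi(p,q)=0$ exactly when their images do. A bijection $f$ of $(\mathbf{T\text{-}R})_k$ is induced by a collineation $\varphi$ if for each $U\in(\mathbf{T\text{-}R})_k$ the points of $f(U)$ are exactly the $\varphi$-images of the points of $U$. (1) If $k\ne n-k$, then every collineation of $\mathfrak P$ preserving $\perp$ induces exactly one bijection of $(\mathbf{T\text{-}R})_k$, and the following three classes of bijections of $(\mathbf{T\text{-}R})_k$ coincide: the automorphisms of $\mathbf{P}((\mathbf{T\text{-}R}),k)$; the bijections preserving $\sim$ in both directions; the bijections induced by collineations of $\mathfrak P$ preserving $\perp$. (2) If $k=n-k$, then every bijection of $(\mathbf{T\text{-}R})_k$ which preserves $\sim$ in both directions is either induced by an automorphism $\varphi$ of $(\mathfrak P,\perp)$, or is the composition of the duality $U\mapsto U^\perp$ and the map induced by an automorphism $\varphi$ of $(\mathfrak P,\perp)$, i.e. $U\mapsto\varphi(U^\perp)$. -/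

import Mathlib

namespace SymplecticGrassmann

section Subspaces

variable {F V : Type*} [Field F] [AddCommGroup V] [Module F V]

/-- `Rad U = U ∩ U^⊥`, where `U^⊥ = {v | ξ u v = 0 for all u ∈ U}`. -/
def rad (ξ : LinearMap.BilinForm F V) (U : Submodule F V) : Submodule F V :=
  U ⊓ ξ.orthogonal U

/-- Regular subspaces: those with zero radical. -/
def IsRegular (ξ : LinearMap.BilinForm F V) (U : Submodule F V) : Prop :=
  rad ξ U = ⊥

/-- Tangential subspaces: those whose radical is a projective point. -/
def IsTangential (ξ : LinearMap.BilinForm F V) (U : Submodule F V) : Prop :=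
  Module.finrank F (rad ξ U) = 1

/-- Membership in `(T-R)_k`: `U` is `k`-dimensional, and it is regular when `k` is even and
tangential when `k` is odd. -/
def IsTR (ξ : LinearMap.BilinForm F V) (k : ℕ) (U : Submodule F V) : Prop :=
  Module.finrank F U = k ∧ (Even k → IsRegular ξ U) ∧ (¬ Even k → IsTangential ξ U)

/-- The set `(T-R)_k`, as a type. -/
abbrev TR (ξ : LinearMap.BilinForm F V) (k : ℕ) : Type _ :=
  {U : Submodule F V // IsTR ξ k U}

/-- The `(T-R)`-pencil `p(H, B)` of all `U` in `(T-R)_k` with `H ⊆ U ⊆ B`. -/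
def pencil (ξ : LinearMap.BilinForm F V) (k : ℕ) (H B : Submodule F V) : Set (TR ξ k) :=
  {U | H ≤ U.1 ∧ U.1 ≤ B}

/-- The lines of the Grassmann space on `(T-R)_k` (used for `1 ≤ k ≤ n - 1`): the nonempty
pencils `p(H, B)` with `H ∈ (T-R)_{k-1}`, `B ∈ (T-R)_{k+1}`, `H ⊆ B`. -/
def pencils (ξ : LinearMap.BilinForm F V) (k : ℕ) : Set (Set (TR ξ k)) :=
  {g | g.Nonempty ∧ ∃ H B : Submodule F V,
    IsTR ξ (k - 1) H ∧ IsTR ξ (k + 1) B ∧ H ≤ B ∧ g = pencil ξ k H B}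

/-- Adjacency on `(T-R)_k`: being distinct and on a common line of the Grassmann space. -/
def Adj (ξ : LinearMap.BilinForm F V) (k : ℕ) (U W : TR ξ k) : Prop :=
  U ≠ W ∧ ∃ g ∈ pencils ξ k, U ∈ g ∧ W ∈ g

/-- The automorphisms of the Grassmann space `⟨(T-R)_k, pencils⟩`: the bijections of the points
under which a set of points is a line if and only if its image is a line. -/
def grassmannAutomorphisms (ξ : LinearMap.BilinForm F V) (k : ℕ) : Set (Equiv.Perm (TR ξ k)) :=
  {f | ∀ g : Set (TR ξ k), f '' g ∈ pencils ξ k ↔ g ∈ pencils ξ k}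

/-- The bijections of `(T-R)_k` which preserve the adjacency in both directions. -/
def adjacencyBijections (ξ : LinearMap.BilinForm F V) (k : ℕ) : Set (Equiv.Perm (TR ξ k)) :=
  {f | ∀ U W : TR ξ k, Adj ξ k (f U) (f W) ↔ Adj ξ k U W}

end Subspaces

section Collineations

variable (F V : Type*) [Field F] [AddCommGroup V] [Module F V]

/-- The set `Sub_j(V)` of the `j`-dimensional subspaces, as a type. -/
abbrev Sub (j : ℕ) : Type _ := {U : Submodule F V // Module.finrank F U = j}

/-- A collineation of the projective space `⟨Sub_1(V), Sub_2(V), ⊂⟩`, i.e. an automorphism of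
this incidence structure. -/
structure Collineation where
  onPoints : Equiv.Perm (Sub F V 1)
  onLines : Equiv.Perm (Sub F V 2)
  incidence : ∀ (p : Sub F V 1) (L : Sub F V 2),
    (onPoints p).1 ≤ (onLines L).1 ↔ p.1 ≤ L.1

variable {F V}

/-- The conjugacy: `ξ(U, W) = 0`. -/
def Conj (ξ : LinearMap.BilinForm F V) (U W : Submodule F V) : Prop :=
  ∀ u ∈ U, ∀ w ∈ W, ξ u w = 0

/-- The collineation preserves the conjugacy, i.e. is an automorphism of `(P, ⊥)`. -/
def Collineation.PreservesConj (ξ : LinearMap.BilinForm F V) (φ : Collineation F V) : Prop :=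
  ∀ p q : Sub F V 1, Conj ξ (φ.onPoints p).1 (φ.onPoints q).1 ↔ Conj ξ p.1 q.1

/-- `φ` takes the subspace `U` to the subspace `W`: the points of `W` are exactly the images of
the points of `U`. A subspace is determined by its points, so there is at most one such `W`. -/
def Collineation.Maps (φ : Collineation F V) (U W : Submodule F V) : Prop :=
  ∀ p : Sub F V 1, (φ.onPoints p).1 ≤ W ↔ p.1 ≤ U

/-- The bijections of `(T-R)_k` of the form `U ↦ φ(U)`, with `φ` a collineation preserving the
conjugacy. -/
def inducedBijections (ξ : LinearMap.BilinForm F V) (k : ℕ) : Set (Equiv.Perm (TR ξ k)) :=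
  {f | ∃ φ : Collineation F V, φ.PreservesConj ξ ∧ ∀ U : TR ξ k, φ.Maps U.1 (f U).1}

/-- The bijections of `(T-R)_k` of the form `U ↦ φ(U^⊥)`, with `φ` a collineation preserving the
conjugacy. -/
def dualInducedBijections (ξ : LinearMap.BilinForm F V) (k : ℕ) : Set (Equiv.Perm (TR ξ k)) :=
  {f | ∃ φ : Collineation F V, φ.PreservesConj ξ ∧
    ∀ U : TR ξ k, φ.Maps (ξ.orthogonal U.1) (f U).1}

end Collineations

end SymplecticGrassmann

open SymplecticGrassmann

/-!
Call two elements of `(T-R)_{m+1}` near if they meet in an element of `(T-R)_m` or span an element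
of `(T-R)_{m+2}`. Two nonadjacent elements are near exactly when they have enough common neighbours,
so nearness is determined by adjacency. The maximal cliques of nearness which contain an adjacent
pair are the stars (all `U` containing a given `H ∈ (T-R)_m`) and the tops (all `U` contained in a
given `B ∈ (T-R)_{m+2}`). By connectivity, a bijection preserving adjacency either preserves
the two types or exchanges them, and an exchange followed by `U ↦ U^⊥` preserves them.

A type-preserving bijection acts on the vertices of the stars, that is on `(T-R)_m`, compatibly with
inclusion. There adjacency is determined by the inclusions in elements of `(T-R)_{m+1}`, so one can
descend to points, whose adjacency is nonorthogonality. A permutation of the points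
preserving `⊥` extends to all subspaces because every subspace is an intersection of hyperplanes
`p^⊥`. The descent also shows that an exchange is only possible if `2 k = n`.
-/

namespace SymplecticGrassmann

open Module Submodule
open LinearMap (BilinForm)

variable {F V : Type*} [Field F] [AddCommGroup V] [Module F V] {ξ : BilinForm F V} {m m' : ℕ}

/-! ### Orthogonal complements -/

section Orthogonal

theorem le_orthogonal_comm (hrefl : ξ.IsRefl) {A B : Submodule F V} :
    A ≤ ξ.orthogonal B ↔ B ≤ ξ.orthogonal A :=
  ⟨fun h b hb _ ha => hrefl _ _ (h ha b hb), fun h a ha _ hb => hrefl _ _ (h hb a ha)⟩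

theorem orthogonal_sup (A B : Submodule F V) :
    ξ.orthogonal (A ⊔ B) = ξ.orthogonal A ⊓ ξ.orthogonal B := by
  apply le_antisymm
  · exact le_inf (BilinForm.orthogonal_le le_sup_left) (BilinForm.orthogonal_le le_sup_right)
  · rintro x ⟨hA, hB⟩ y hy
    obtain ⟨a, ha, b, hb, rfl⟩ := mem_sup.1 hy
    simp [hA a ha, hB b hb]

theorem mem_orthogonal_span_singleton_iff {x y : V} :
    y ∈ ξ.orthogonal (span F {x}) ↔ ξ x y = 0 := by
  refine ⟨fun h => h x (mem_span_singleton_self x), fun h z hz => ?_⟩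
  obtain ⟨c, rfl⟩ := mem_span_singleton.1 hz
  simp [h]

variable [FiniteDimensional F V]

theorem finrank_add_finrank_orthogonal (hnd : ξ.Nondegenerate) (U : Submodule F V) :
    finrank F U + finrank F (ξ.orthogonal U) = finrank F V := by
  rw [BilinForm.finrank_orthogonal hnd, Nat.add_sub_cancel' U.finrank_le]

theorem orthogonal_le_orthogonal_iff (hrefl : ξ.IsRefl) (hnd : ξ.Nondegenerate)
    {A B : Submodule F V} : ξ.orthogonal A ≤ ξ.orthogonal B ↔ B ≤ A := by
  rw [le_orthogonal_comm hrefl, BilinForm.orthogonal_orthogonal hnd hrefl]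

theorem orthogonal_inf (hrefl : ξ.IsRefl) (hnd : ξ.Nondegenerate) (A B : Submodule F V) :
    ξ.orthogonal (A ⊓ B) = ξ.orthogonal A ⊔ ξ.orthogonal B := by
  have h := BilinForm.orthogonal_orthogonal hnd hrefl
  rw [← h (ξ.orthogonal A ⊔ ξ.orthogonal B), orthogonal_sup, h, h]

end Orthogonal

section Radical

theorem rad_span_singleton (halt : ξ.IsAlt) (y : V) : rad ξ (span F {y}) = span F {y} :=
  inf_eq_left.2 <| (span_singleton_le_iff_mem _ _).2 <|
    mem_orthogonal_span_singleton_iff.2 (halt y)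

theorem IsRegular.sup_inf_orthogonal {H W : Submodule F V} (hH : IsRegular ξ H)
    (hW : W ≤ ξ.orthogonal H) : (H ⊔ W) ⊓ ξ.orthogonal H = W := by
  rw [sup_comm, sup_inf_assoc_of_le H hW, show H ⊓ ξ.orthogonal H = ⊥ from hH, sup_bot_eq]

theorem IsRegular.rad_sup {H W : Submodule F V} (hH : IsRegular ξ H)
    (hW : W ≤ ξ.orthogonal H) : rad ξ (H ⊔ W) = rad ξ W := by
  rw [rad, orthogonal_sup, ← inf_assoc, hH.sup_inf_orthogonal hW, rad]

theorem IsRegular.disjoint {H : Submodule F V} (hH : IsRegular ξ H) :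
    Disjoint H (ξ.orthogonal H) :=
  disjoint_iff.2 hH

theorem IsRegular.notMem {H : Submodule F V} (hH : IsRegular ξ H) {y : V}
    (hy : y ∈ ξ.orthogonal H) (h0 : y ≠ 0) : y ∉ H :=
  fun h => h0 (disjoint_def.1 hH.disjoint y h hy)

theorem IsRegular.exists_apply_ne_zero (hrefl : ξ.IsRefl) {U : Submodule F V}
    (hU : IsRegular ξ U) {y : V} (hy : y ∈ U) (h0 : y ≠ 0) : ∃ z ∈ U, ξ y z ≠ 0 := by
  by_contra! h
  exact h0 (disjoint_def.1 hU.disjoint y hy fun u hu => hrefl _ _ (h u hu))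

theorem isRegular_span_pair_iff (halt : ξ.IsAlt) {y z : V} (hy : y ≠ 0) :
    IsRegular ξ (span F {y, z}) ↔ ξ y z ≠ 0 := by
  have hmem {x : V} : x ∈ rad ξ (span F {y, z}) ↔
      (∃ a b : F, a • y + b • z = x) ∧ ξ y x = 0 ∧ ξ z x = 0 := by
    rw [rad, mem_inf, mem_span_pair, span_insert, orthogonal_sup, mem_inf,
      mem_orthogonal_span_singleton_iff, mem_orthogonal_span_singleton_iff]
  rw [IsRegular, Submodule.eq_bot_iff]
  constructor
  · exact fun h hyz => hy (h y (hmem.2 ⟨⟨1, 0, by simp⟩, halt y, halt.isRefl _ _ hyz⟩))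
  · intro hyz x hx
    obtain ⟨⟨a, b, rfl⟩, h1, h2⟩ := hmem.1 hx
    have hzy : ξ z y ≠ 0 := fun h => hyz (halt.isRefl _ _ h)
    have hb : b = 0 := by simpa [halt y, hyz] using h1
    have ha : a = 0 := by simpa [halt z, hzy] using h2
    simp [ha, hb]

theorem isRegular_bot : IsRegular ξ ⊥ :=
  bot_inf_eq _

theorem IsTangential.exists_mem_rad_ne_zero {U : Submodule F V} (hU : IsTangential ξ U) :
    ∃ r ∈ rad ξ U, r ≠ 0 :=
  exists_mem_ne_zero_of_ne_bot (isAtom_iff_finrank_eq_one.2 hU).ne_bot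

theorem IsTangential.rad_eq_span {U : Submodule F V} (hU : IsTangential ξ U) {r : V}
    (hr : r ∈ rad ξ U) (h0 : r ≠ 0) : rad ξ U = span F {r} :=
  ((isAtom_iff_finrank_eq_one.2 hU).le_iff_eq (by simpa using h0)).1
    ((span_singleton_le_iff_mem _ _).2 hr) |>.symm

theorem IsTangential.isRegular_sup_span (hrefl : ξ.IsRefl) {H : Submodule F V}
    (hH : IsTangential ξ H) {r w : V} (hr : r ∈ rad ξ H) (hrw : ξ r w ≠ 0) :
    IsRegular ξ (H ⊔ span F {w}) := by
  refine (Submodule.eq_bot_iff _).2 fun x ⟨hxsup, hx⟩ => ?_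
  rw [SetLike.mem_coe, orthogonal_sup, mem_inf, mem_orthogonal_span_singleton_iff] at hx
  obtain ⟨h, hh, z, hz, rfl⟩ := mem_sup.1 hxsup
  obtain ⟨c, rfl⟩ := mem_span_singleton.1 hz
  obtain rfl : c = 0 := by simpa [hrefl _ _ (hr.2 h hh), hrw] using hx.1 r hr.1
  rw [zero_smul, add_zero] at hx ⊢
  have hspan : h ∈ rad ξ H := ⟨hh, hx.1⟩
  rw [hH.rad_eq_span hr (by rintro rfl; simp at hrw)] at hspan
  obtain ⟨d, rfl⟩ := mem_span_singleton.1 hspan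
  have hwr : ξ w r ≠ 0 := fun h => hrw (hrefl _ _ h)
  obtain rfl : d = 0 := by simpa [hwr] using hx.2
  exact zero_smul F r

theorem finrank_span_pair (halt : ξ.IsAlt) {y z : V} (hyz : ξ y z ≠ 0) :
    finrank F (span F {y, z}) = 2 := by
  have hind : LinearIndependent F ![y, z] := by
    refine LinearIndependent.pair_iff.2 fun a b hab => ?_
    have hzy : ξ z y ≠ 0 := fun h => hyz (halt.isRefl _ _ h)
    have hy := congrArg (ξ y) hab
    have hz := congrArg (ξ z) hab
    exact ⟨by simpa [halt z, hzy] using hz, by simpa [halt y, hyz] using hy⟩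
  rw [← Matrix.range_cons_cons_empty y z ![], finrank_span_eq_card hind, Fintype.card_fin]

theorem isRegular_top (hnd : ξ.Nondegenerate) : IsRegular ξ (⊤ : Submodule F V) := by
  rw [IsRegular, rad, BilinForm.orthogonal_top_eq_bot hnd, inf_bot_eq]

variable [FiniteDimensional F V]

theorem rad_orthogonal (hrefl : ξ.IsRefl) (hnd : ξ.Nondegenerate) (U : Submodule F V) :
    rad ξ (ξ.orthogonal U) = rad ξ U := by
  rw [rad, rad, BilinForm.orthogonal_orthogonal hnd hrefl, inf_comm]

theorem isRegular_orthogonal_iff (hrefl : ξ.IsRefl) (hnd : ξ.Nondegenerate) {U : Submodule F V} :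
    IsRegular ξ (ξ.orthogonal U) ↔ IsRegular ξ U := by
  rw [IsRegular, IsRegular, rad_orthogonal hrefl hnd]

theorem isTangential_orthogonal_iff (hrefl : ξ.IsRefl) (hnd : ξ.Nondegenerate)
    {U : Submodule F V} : IsTangential ξ (ξ.orthogonal U) ↔ IsTangential ξ U := by
  rw [IsTangential, IsTangential, rad_orthogonal hrefl hnd]

theorem IsRegular.isCompl (hrefl : ξ.IsRefl) {H : Submodule F V} (hH : IsRegular ξ H) :
    IsCompl H (ξ.orthogonal H) :=
  (BilinForm.isCompl_orthogonal_iff_disjoint hrefl).2 hH.disjoint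

theorem IsRegular.exists_add_eq (hrefl : ξ.IsRefl) {H : Submodule F V} (hH : IsRegular ξ H)
    (v : V) : ∃ h ∈ H, ∃ d ∈ ξ.orthogonal H, h + d = v :=
  mem_sup.1 ((hH.isCompl hrefl).sup_eq_top.ge mem_top)

theorem IsRegular.finrank_sup {H W : Submodule F V} (hH : IsRegular ξ H)
    (hW : W ≤ ξ.orthogonal H) : finrank F ↥(H ⊔ W) = finrank F H + finrank F W := by
  rw [← finrank_sup_add_finrank_inf_eq, (hH.disjoint.mono_right hW).eq_bot, finrank_bot, add_zero]

theorem IsRegular.exists_eq_sup_span (hrefl : ξ.IsRefl) {H X : Submodule F V}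
    (hH : IsRegular ξ H) (hHX : H ≤ X) (hX : finrank F X = finrank F H + 1) :
    ∃ y ∈ ξ.orthogonal H, y ≠ 0 ∧ X = H ⊔ span F {y} := by
  have hsup : H ⊔ ξ.orthogonal H ⊓ X = X := by
    rw [← sup_inf_assoc_of_le _ hHX, (hH.isCompl hrefl).sup_eq_top, top_inf_eq]
  have hrank : finrank F ↥(ξ.orthogonal H ⊓ X) = 1 := by
    rw [← hsup, hH.finrank_sup inf_le_left] at hX
    omega
  obtain ⟨y, hy, h0⟩ := exists_mem_ne_zero_of_ne_bot
    (isAtom_iff_finrank_eq_one.2 hrank).ne_bot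
  refine ⟨y, hy.1, h0, (eq_of_le_of_finrank_le ?_ ?_).symm⟩
  · exact sup_le hHX ((span_singleton_le_iff_mem _ _).2 hy.2)
  · rw [finrank_sup_span_singleton (hH.notMem hy.1 h0), hX]

theorem IsRegular.isTangential_of_le (halt : ξ.IsAlt) {H X : Submodule F V}
    (hH : IsRegular ξ H) (hHX : H ≤ X) (hX : finrank F X = finrank F H + 1) :
    IsTangential ξ X := by
  obtain ⟨y, hy, h0, rfl⟩ := hH.exists_eq_sup_span halt.isRefl hHX hX
  rw [IsTangential, hH.rad_sup ((span_singleton_le_iff_mem _ _).2 hy),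
    rad_span_singleton halt, finrank_span_singleton h0]

theorem IsRegular.isTangential_of_ge (halt : ξ.IsAlt) (hnd : ξ.Nondegenerate)
    {H U : Submodule F V} (hU : IsRegular ξ U) (hHU : H ≤ U) (hH : finrank F H + 1 = finrank F U) :
    IsTangential ξ H := by
  rw [← isTangential_orthogonal_iff halt.isRefl hnd]
  rw [← isRegular_orthogonal_iff halt.isRefl hnd] at hU
  refine hU.isTangential_of_le halt (BilinForm.orthogonal_le hHU) ?_
  have := finrank_add_finrank_orthogonal hnd U
  have := finrank_add_finrank_orthogonal hnd H
  omega

theorem IsRegular.exists_forall_apply_eq (halt : ξ.IsAlt) (hnd : ξ.Nondegenerate)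
    {U : Submodule F V} (hU : IsRegular ξ U) {ι : Type*} {v : ι → V} (hv : LinearIndependent F v)
    (hvU : ∀ i, v i ∈ U) (c : ι → F) : ∃ d ∈ U, ∀ i, ξ (v i) d = c i := by
  obtain ⟨g, hg⟩ := LinearMap.exists_extend ((Basis.span hv).constr F c)
  have hgv (i : ι) : g (v i) = c i := by
    have := LinearMap.congr_fun hg (Basis.span hv i)
    rwa [Basis.constr_basis, LinearMap.comp_apply, subtype_apply, Basis.span_apply] at this
  obtain ⟨d, hd, e, he, hde⟩ := hU.exists_add_eq halt.isRefl ((ξ.toDual hnd).symm (-g))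
  refine ⟨d, hd, fun i => ?_⟩
  have hvd : ξ (v i) (d + e) = c i := by
    rw [← halt.neg_eq, hde, BilinForm.apply_toDual_symm_apply, LinearMap.neg_apply, neg_neg, hgv]
  rwa [map_add, he (v i) (hvU i), add_zero] at hvd

/-- A regular subspace of dimension `2 * j + 2` is obtained from one of dimension `2 * j` by
adding a hyperbolic line of its orthogonal complement. -/
theorem exists_isRegular_finrank_eq (halt : ξ.IsAlt) (hnd : ξ.Nondegenerate) {j : ℕ}
    (hj : 2 * j ≤ finrank F V + 1) :
    ∃ H : Submodule F V, finrank F H = 2 * j ∧ IsRegular ξ H := by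
  induction j with
  | zero => exact ⟨⊥, by simp, isRegular_bot⟩
  | succ j ih =>
    obtain ⟨H, hd, hH⟩ := ih (by omega)
    have hcompl := finrank_add_finrank_orthogonal hnd H
    obtain ⟨y, hy, h0⟩ := exists_mem_ne_zero_of_ne_bot
      (fun h : ξ.orthogonal H = ⊥ => by rw [h, finrank_bot] at hcompl; omega)
    obtain ⟨z, hz, hyz⟩ :=
      ((isRegular_orthogonal_iff halt.isRefl hnd).2 hH).exists_apply_ne_zero halt.isRefl hy h0
    have hle : span F {y, z} ≤ ξ.orthogonal H := span_le.2 (Set.pair_subset hy hz)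
    refine ⟨H ⊔ span F {y, z}, ?_, ?_⟩
    · rw [hH.finrank_sup hle, hd, finrank_span_pair halt hyz, mul_add_one]
    · rw [IsRegular, hH.rad_sup hle]
      exact (isRegular_span_pair_iff halt h0).2 hyz

theorem even_finrank (halt : ξ.IsAlt) (hnd : ξ.Nondegenerate) : Even (finrank F V) := by
  by_contra hodd
  obtain ⟨j, hj⟩ := Nat.not_even_iff_odd.1 hodd
  obtain ⟨H, hd, -⟩ := exists_isRegular_finrank_eq halt hnd (j := j + 1) (by omega)
  have := H.finrank_le
  omega

end Radical

section Hyperplanes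

variable [FiniteDimensional F V]

theorem sup_eq_of_finrank {A B X : Submodule F V} (hA : A ≤ X) (hB : B ≤ X)
    (hAX : finrank F A + 1 = finrank F X) (hAB : finrank F A = finrank F B) (hne : A ≠ B) :
    A ⊔ B = X := by
  refine eq_of_le_of_finrank_le (sup_le hA hB) ?_
  have hlt : A < A ⊔ B := left_lt_sup.2 fun hBA => hne (eq_of_le_of_finrank_eq hBA hAB.symm).symm
  have := finrank_lt_finrank_of_lt hlt
  omega

theorem inf_eq_of_finrank {A X Y : Submodule F V} (hX : A ≤ X) (hY : A ≤ Y)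
    (hAX : finrank F A + 1 = finrank F X) (hXY : finrank F X = finrank F Y) (hne : X ≠ Y) :
    X ⊓ Y = A := by
  refine (eq_of_le_of_finrank_le (le_inf hX hY) ?_).symm
  have hlt : X ⊓ Y < X := inf_lt_left.2 fun hle => hne (eq_of_le_of_finrank_eq hle hXY)
  have := finrank_lt_finrank_of_lt hlt
  omega

end Hyperplanes

/-! ### Elements of `(T-R)_k` and their adjacency -/

section TR

theorem isTR_iff_of_even {k : ℕ} (hk : Even k) {U : Submodule F V} :
    IsTR ξ k U ↔ finrank F U = k ∧ IsRegular ξ U := by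
  simp [IsTR, hk]

theorem isTR_iff_of_not_even {k : ℕ} (hk : ¬ Even k) {U : Submodule F V} :
    IsTR ξ k U ↔ finrank F U = k ∧ IsTangential ξ U := by
  simp [IsTR, hk]

theorem IsTR.isRegular {k : ℕ} {U : Submodule F V} (hU : IsTR ξ k U) (hk : Even k) :
    IsRegular ξ U :=
  hU.2.1 hk

theorem IsTR.isTangential {k : ℕ} {U : Submodule F V} (hU : IsTR ξ k U) (hk : ¬ Even k) :
    IsTangential ξ U :=
  hU.2.2 hk

theorem TR.finrank_eq {k : ℕ} (X : TR ξ k) : finrank F X.1 = k :=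
  X.2.1

variable [FiniteDimensional F V]

theorem IsTR.succ_of_le (halt : ξ.IsAlt) (hm : Even m) {U B : Submodule F V} (hU : IsTR ξ m U)
    (hUB : U ≤ B) (hB : finrank F B = m + 1) : IsTR ξ (m + 1) B :=
  (isTR_iff_of_not_even (by simpa [Nat.even_add_one] using hm)).2
    ⟨hB, (hU.isRegular hm).isTangential_of_le halt hUB (by rw [hB, hU.1])⟩

theorem IsTR.of_succ_of_ge (halt : ξ.IsAlt) (hnd : ξ.Nondegenerate) (hm : Even (m + 1))
    {H U : Submodule F V} (hU : IsTR ξ (m + 1) U) (hHU : H ≤ U) (hH : finrank F H = m) :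
    IsTR ξ m H :=
  (isTR_iff_of_not_even (Nat.even_add_one.1 hm)).2
    ⟨hH, (hU.isRegular hm).isTangential_of_ge halt hnd hHU (by rw [hH, hU.1])⟩

theorem isTR_orthogonal_iff (halt : ξ.IsAlt) (hnd : ξ.Nondegenerate) (h : m + m' = finrank F V)
    {U : Submodule F V} : IsTR ξ m' (ξ.orthogonal U) ↔ IsTR ξ m U := by
  have hparity : Even m ↔ Even m' := Nat.even_add.1 (h ▸ even_finrank halt hnd)
  have hrank : finrank F (ξ.orthogonal U) = m' ↔ finrank F U = m := by
    have := finrank_add_finrank_orthogonal hnd U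
    omega
  rw [IsTR, IsTR, isRegular_orthogonal_iff halt.isRefl hnd,
    isTangential_orthogonal_iff halt.isRefl hnd, hparity, hrank]

theorem TR.eq_of_le {k : ℕ} {X Y : TR ξ k} (h : X.1 ≤ Y.1) : X = Y :=
  Subtype.ext (eq_of_le_of_finrank_eq h (by rw [X.finrank_eq, Y.finrank_eq]))

theorem TR.inf_eq {X Y : TR ξ (m + 1)} (h : X ≠ Y) {H : Submodule F V} (hH : finrank F H = m)
    (hX : H ≤ X.1) (hY : H ≤ Y.1) : X.1 ⊓ Y.1 = H :=
  inf_eq_of_finrank hX hY (by rw [hH, X.finrank_eq]) (by rw [X.finrank_eq, Y.finrank_eq])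
    (Subtype.coe_ne_coe.2 h)

theorem TR.sup_eq {X Y : TR ξ (m + 1)} (h : X ≠ Y) {B : Submodule F V} (hB : finrank F B = m + 2)
    (hX : X.1 ≤ B) (hY : Y.1 ≤ B) : X.1 ⊔ Y.1 = B :=
  sup_eq_of_finrank hX hY (by rw [hB, X.finrank_eq]) (by rw [X.finrank_eq, Y.finrank_eq])
    (Subtype.coe_ne_coe.2 h)

theorem TR.finrank_inf_le {X Y : TR ξ (m + 1)} (h : X ≠ Y) : finrank F ↥(X.1 ⊓ Y.1) ≤ m := by
  have := finrank_lt_finrank_of_lt (inf_lt_left.2 fun hle => h (TR.eq_of_le hle))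
  rw [X.finrank_eq] at this
  omega

theorem TR.finrank_sup_add_finrank_inf (X Y : TR ξ (m + 1)) :
    finrank F ↥(X.1 ⊔ Y.1) + finrank F ↥(X.1 ⊓ Y.1) = 2 * m + 2 := by
  rw [finrank_sup_add_finrank_inf_eq, X.finrank_eq, Y.finrank_eq]
  ring

theorem adj_iff {X Y : TR ξ (m + 1)} :
    Adj ξ (m + 1) X Y ↔ X ≠ Y ∧ IsTR ξ m (X.1 ⊓ Y.1) ∧ IsTR ξ (m + 2) (X.1 ⊔ Y.1) := by
  constructor
  · rintro ⟨hne, g, ⟨-, H, B, hH, hB, -, rfl⟩, hX, hY⟩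
    refine ⟨hne, ?_, ?_⟩
    · rwa [TR.inf_eq hne hH.1 hX.1 hY.1]
    · rwa [TR.sup_eq hne hB.1 hX.2 hY.2]
  · rintro ⟨hne, hH, hB⟩
    exact ⟨hne, pencil ξ (m + 1) (X.1 ⊓ Y.1) (X.1 ⊔ Y.1),
      ⟨⟨X, inf_le_left, le_sup_left⟩, _, _, hH, hB, inf_le_left.trans le_sup_left, rfl⟩,
      ⟨inf_le_left, le_sup_left⟩, ⟨inf_le_right, le_sup_right⟩⟩

theorem adj_of_even (halt : ξ.IsAlt) (hnd : ξ.Nondegenerate) (hm : Even (m + 1))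
    {X Y : TR ξ (m + 1)} (hne : X ≠ Y) (h : finrank F ↥(X.1 ⊓ Y.1) = m) :
    Adj ξ (m + 1) X Y := by
  have := X.finrank_sup_add_finrank_inf Y
  exact adj_iff.2 ⟨hne, X.2.of_succ_of_ge halt hnd hm inf_le_left h,
    X.2.succ_of_le halt hm le_sup_left (by omega)⟩

end TR

section Graph

/-- The adjacency of the Grassmann space `P((T-R), k)` as a simple graph, so that a bijection
preserving adjacency in both directions is a graph isomorphism. -/
def grassmannGraph (ξ : BilinForm F V) (k : ℕ) : SimpleGraph (TR ξ k) where
  Adj := Adj ξ k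
  symm := ⟨fun _ _ ⟨hne, g, hg, hX, hY⟩ => ⟨hne.symm, g, hg, hY, hX⟩⟩
  loopless := ⟨fun _ h => h.1 rfl⟩

variable [FiniteDimensional F V]

/-- The duality `U ↦ U^⊥`, an isomorphism from `(T-R)_{m+1}` to `(T-R)_{n-m-1}`. -/
def orthogonalIso (halt : ξ.IsAlt) (hnd : ξ.Nondegenerate)
    (h : (m + 1) + (m' + 1) = finrank F V) :
    grassmannGraph ξ (m + 1) ≃g grassmannGraph ξ (m' + 1) where
  toFun U := ⟨ξ.orthogonal U.1, (isTR_orthogonal_iff halt hnd h).2 U.2⟩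
  invFun U := ⟨ξ.orthogonal U.1, (isTR_orthogonal_iff halt hnd (by omega)).2 U.2⟩
  left_inv U := Subtype.ext (BilinForm.orthogonal_orthogonal hnd halt.isRefl U.1)
  right_inv U := Subtype.ext (BilinForm.orthogonal_orthogonal hnd halt.isRefl U.1)
  map_rel_iff' {X Y} := by
    have hne : ξ.orthogonal X.1 ≠ ξ.orthogonal Y.1 ↔ X.1 ≠ Y.1 :=
      not_congr ⟨fun e => by
        rw [← BilinForm.orthogonal_orthogonal hnd halt.isRefl X.1, e,
          BilinForm.orthogonal_orthogonal hnd halt.isRefl], fun e => by rw [e]⟩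
    change Adj ξ (m' + 1) _ _ ↔ Adj ξ (m + 1) X Y
    simp only [adj_iff, Equiv.coe_fn_mk, ne_eq, Subtype.ext_iff, ← orthogonal_sup,
      ← orthogonal_inf halt.isRefl hnd] at hne ⊢
    rw [hne, isTR_orthogonal_iff (m := m + 2) halt hnd (by omega),
      isTR_orthogonal_iff (m := m) halt hnd (by omega), and_comm (a := IsTR ξ (m + 2) _)]

end Graph

section Adjoin

/-- The tangential subspace with radical `span {y}` obtained from a regular `H` and a nonzero
`y ∈ H^⊥`; all elements of `(T-R)_{m+1}` containing `H` arise in this way. -/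
def IsTR.adjoin [FiniteDimensional F V] (halt : ξ.IsAlt) (hm : Even m) {H : Submodule F V}
    (hH : IsTR ξ m H) {y : V} (hy : y ∈ ξ.orthogonal H) (h0 : y ≠ 0) : TR ξ (m + 1) :=
  ⟨H ⊔ span F {y}, hH.succ_of_le halt hm le_sup_left
    (by rw [finrank_sup_span_singleton ((hH.isRegular hm).notMem hy h0), hH.1])⟩

variable [FiniteDimensional F V] (halt : ξ.IsAlt) (hm : Even m) {H : Submodule F V}
  (hH : IsTR ξ m H) {y z : V} (hy : y ∈ ξ.orthogonal H) (hy0 : y ≠ 0) (hz : z ∈ ξ.orthogonal H)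
  (hz0 : z ≠ 0)
include halt hm hH hy hy0

theorem IsTR.le_adjoin : H ≤ (hH.adjoin halt hm hy hy0).1 :=
  le_sup_left

theorem IsTR.mem_adjoin : y ∈ (hH.adjoin halt hm hy hy0).1 :=
  mem_sup_right (mem_span_singleton_self y)

theorem IsTR.adjoin_le_iff {U : Submodule F V} (hHU : H ≤ U) :
    (hH.adjoin halt hm hy hy0).1 ≤ U ↔ y ∈ U := by
  simp [IsTR.adjoin, hHU]

omit hy hy0 in
theorem IsTR.exists_eq_adjoin {X : TR ξ (m + 1)} (hHX : H ≤ X.1) :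
    ∃ y, ∃ (hy : y ∈ ξ.orthogonal H) (h0 : y ≠ 0), X = hH.adjoin halt hm hy h0 := by
  obtain ⟨y, hy, h0, hX⟩ := (hH.isRegular hm).exists_eq_sup_span halt.isRefl hHX
    (by rw [X.finrank_eq, hH.1])
  exact ⟨y, hy, h0, Subtype.ext hX⟩

theorem IsTR.mem_adjoin_iff (hz : z ∈ ξ.orthogonal H) :
    z ∈ (hH.adjoin halt hm hy hy0).1 ↔ z ∈ span F {y} := by
  conv_rhs => rw [← (hH.isRegular hm).sup_inf_orthogonal
    ((span_singleton_le_iff_mem y _).2 hy), mem_inf, and_iff_left hz]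
  rfl

include hz hz0

theorem IsTR.adjoin_eq_adjoin_iff :
    hH.adjoin halt hm hy hy0 = hH.adjoin halt hm hz hz0 ↔ y ∈ span F {z} := by
  rw [← hH.mem_adjoin_iff halt hm hz hz0 hy]
  refine ⟨fun h => h ▸ hH.mem_adjoin halt hm hy hy0, fun h => TR.eq_of_le ?_⟩
  exact (hH.adjoin_le_iff halt hm hy hy0 (hH.le_adjoin halt hm hz hz0)).2 h

theorem IsTR.adjoin_sup_adjoin :
    (hH.adjoin halt hm hy hy0).1 ⊔ (hH.adjoin halt hm hz hz0).1 = H ⊔ span F {y, z} := by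
  rw [IsTR.adjoin, IsTR.adjoin, ← sup_sup_distrib_left, span_insert]

theorem IsTR.adj_adjoin_iff :
    Adj ξ (m + 1) (hH.adjoin halt hm hy hy0) (hH.adjoin halt hm hz hz0) ↔ ξ y z ≠ 0 := by
  have hle : span F {y, z} ≤ ξ.orthogonal H := span_le.2 (Set.pair_subset hy hz)
  have hreg : IsRegular ξ (H ⊔ span F {y, z}) ↔ ξ y z ≠ 0 := by
    rw [IsRegular, (hH.isRegular hm).rad_sup hle, ← isRegular_span_pair_iff halt hy0, IsRegular]
  rw [adj_iff, hH.adjoin_sup_adjoin, isTR_iff_of_even (hm.add even_two), hreg]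
  refine ⟨fun h => h.2.2.2, fun hyz => ?_⟩
  have hne : hH.adjoin halt hm hy hy0 ≠ hH.adjoin halt hm hz hz0 := by
    rw [Ne, hH.adjoin_eq_adjoin_iff halt hm hy hy0 hz hz0, mem_span_singleton]
    rintro ⟨c, rfl⟩
    simp [halt z] at hyz
  refine ⟨hne, ?_, ?_, hyz⟩
  · rwa [TR.inf_eq hne hH.1 (hH.le_adjoin halt hm hy hy0) (hH.le_adjoin halt hm hz hz0)]
  · rw [(hH.isRegular hm).finrank_sup hle, hH.1, finrank_span_pair halt hyz]

end Adjoin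

/-! ### Nearness is determined by adjacency -/

section Diamond

/-- `x` and `y` have two adjacent common neighbours `a`, `b` and two distinct nonadjacent common
neighbours `p`, `q` such that `p` and `q` are adjacent to `a` and `b`. -/
def HasDiamond {α : Type*} (G : SimpleGraph α) (x y : α) : Prop :=
  ∃ a b p q, {a, b, p, q} ⊆ G.commonNeighbors x y ∧ {a, b} ⊆ G.commonNeighbors p q ∧
    G.Adj a b ∧ p ≠ q ∧ ¬ G.Adj p q

variable {α β : Type*} {G : SimpleGraph α} {G' : SimpleGraph β}

theorem HasDiamond.map (f : G ≃g G') {x y : α} (h : HasDiamond G x y) :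
    HasDiamond G' (f x) (f y) := by
  obtain ⟨a, b, p, q, h⟩ := h
  refine ⟨f a, f b, f p, f q, ?_⟩
  simpa only [Set.insert_subset_iff, Set.singleton_subset_iff, SimpleGraph.mem_commonNeighbors,
    f.map_adj_iff, f.injective.ne_iff] using h

theorem hasDiamond_map_iff (f : G ≃g G') {x y : α} :
    HasDiamond G' (f x) (f y) ↔ HasDiamond G x y :=
  ⟨fun h => by simpa only [RelIso.symm_apply_apply] using h.map f.symm, HasDiamond.map f⟩

end Diamond

section Distant

variable [FiniteDimensional F V] {X Y P Q : TR ξ (m + 1)}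

theorem inf_sup_inf_of_adj (hd : finrank F ↥(X.1 ⊓ Y.1) < m) (hPX : Adj ξ (m + 1) P X)
    (hPY : Adj ξ (m + 1) P Y) : P.1 ⊓ X.1 ⊔ P.1 ⊓ Y.1 = P.1 := by
  have hX : finrank F ↥(P.1 ⊓ X.1) = m := (adj_iff.1 hPX).2.1.1
  have hY : finrank F ↥(P.1 ⊓ Y.1) = m := (adj_iff.1 hPY).2.1.1
  refine sup_eq_of_finrank inf_le_left inf_le_left (by rw [hX, P.finrank_eq]) (by rw [hX, hY])
    fun h => hd.not_ge ?_
  exact hX.ge.trans (finrank_mono (le_inf inf_le_right (h.trans_le inf_le_right)))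

theorem finrank_sup_of_adj (hd : finrank F ↥(X.1 ⊓ Y.1) < m) (hPX : Adj ξ (m + 1) P X)
    (hPY : Adj ξ (m + 1) P Y) : finrank F ↥(X.1 ⊔ Y.1) = m + 3 := by
  have hsum := finrank_sup_add_finrank_inf_eq (P.1 ⊓ X.1) (P.1 ⊓ Y.1)
  rw [inf_sup_inf_of_adj hd hPX hPY, (adj_iff.1 hPX).2.1.1, (adj_iff.1 hPY).2.1.1,
    P.finrank_eq] at hsum
  have hmono : finrank F ↥(P.1 ⊓ X.1 ⊓ (P.1 ⊓ Y.1)) ≤ finrank F ↥(X.1 ⊓ Y.1) :=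
    finrank_mono (inf_le_inf inf_le_right inf_le_right)
  have := X.finrank_sup_add_finrank_inf Y
  omega

/- The next two lemmas make the common neighbourhood of `X` and `Y` a grid, with coordinates
`P ⊓ X` and `P ⊓ Y`; a grid contains no diamond. -/
theorem inf_eq_or_inf_eq_of_adj (hd : finrank F ↥(X.1 ⊓ Y.1) < m) (hPX : Adj ξ (m + 1) P X)
    (hPY : Adj ξ (m + 1) P Y) (hQX : Adj ξ (m + 1) Q X) (hQY : Adj ξ (m + 1) Q Y)
    (hPQ : Adj ξ (m + 1) P Q) : P.1 ⊓ X.1 = Q.1 ⊓ X.1 ∨ P.1 ⊓ Y.1 = Q.1 ⊓ Y.1 := by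
  have hsup : finrank F ↥(X.1 ⊔ Y.1) = m + 3 := finrank_sup_of_adj hd hPX hPY
  by_contra! h
  have hX : P.1 ⊓ X.1 ⊔ Q.1 ⊓ X.1 = X.1 := sup_eq_of_finrank inf_le_right inf_le_right
    (by rw [(adj_iff.1 hPX).2.1.1, X.finrank_eq])
    (by rw [(adj_iff.1 hPX).2.1.1, (adj_iff.1 hQX).2.1.1]) h.1
  have hY : P.1 ⊓ Y.1 ⊔ Q.1 ⊓ Y.1 = Y.1 := sup_eq_of_finrank inf_le_right inf_le_right
    (by rw [(adj_iff.1 hPY).2.1.1, Y.finrank_eq])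
    (by rw [(adj_iff.1 hPY).2.1.1, (adj_iff.1 hQY).2.1.1]) h.2
  have hle : X.1 ⊔ Y.1 ≤ P.1 ⊔ Q.1 := by
    rw [← hX, ← hY]
    exact sup_le (sup_le_sup inf_le_left inf_le_left) (sup_le_sup inf_le_left inf_le_left)
  have := finrank_mono hle
  rw [hsup, (adj_iff.1 hPQ).2.2.1] at this
  omega

theorem adj_of_inf_eq (hd : finrank F ↥(X.1 ⊓ Y.1) < m) (hPX : Adj ξ (m + 1) P X)
    (hPY : Adj ξ (m + 1) P Y) (hQX : Adj ξ (m + 1) Q X) (hQY : Adj ξ (m + 1) Q Y) (hne : P ≠ Q)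
    (h : P.1 ⊓ X.1 = Q.1 ⊓ X.1) : Adj ξ (m + 1) P Q := by
  obtain ⟨-, hH, -⟩ := adj_iff.1 hPX
  obtain ⟨-, -, hB⟩ := adj_iff.1 hPY
  have hQ : Q.1 ≤ P.1 ⊔ Y.1 := by
    rw [← inf_sup_inf_of_adj hd hQX hQY, ← h]
    exact sup_le_sup inf_le_left inf_le_right
  refine adj_iff.2 ⟨hne, ?_, ?_⟩
  · rwa [TR.inf_eq hne hH.1 inf_le_left (h.trans_le inf_le_left)]
  · rwa [TR.sup_eq hne hB.1 le_sup_left hQ]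

theorem not_hasDiamond_of_finrank_inf_lt (hd : finrank F ↥(X.1 ⊓ Y.1) < m) :
    ¬ HasDiamond (grassmannGraph ξ (m + 1)) X Y := by
  rintro ⟨A, B, P, Q, hXY, hPQ, hAB, hne, hnadj⟩
  simp only [Set.insert_subset_iff, Set.singleton_subset_iff,
    SimpleGraph.mem_commonNeighbors] at hXY hPQ
  wlog h : A.1 ⊓ X.1 = B.1 ⊓ X.1 generalizing X Y
  · have hXY' := hXY
    simp only [and_comm (a := (grassmannGraph ξ (m + 1)).Adj X _)] at hXY'
    exact this (inf_comm X.1 Y.1 ▸ hd) hXY' ((inf_eq_or_inf_eq_of_adj hd hXY.1.1.symm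
      hXY.1.2.symm hXY.2.1.1.symm hXY.2.1.2.symm hAB).resolve_left h)
  obtain ⟨⟨hXA, hYA⟩, ⟨hXB, hYB⟩, ⟨hXP, hYP⟩, hXQ, hYQ⟩ := hXY
  have hY : A.1 ⊓ Y.1 ≠ B.1 ⊓ Y.1 := fun hY => hAB.ne <| Subtype.ext <| by
    rw [← inf_sup_inf_of_adj hd hXA.symm hYA.symm, h, hY,
      inf_sup_inf_of_adj hd hXB.symm hYB.symm]
  have htrace {Z : TR ξ (m + 1)} (hXZ : (grassmannGraph ξ (m + 1)).Adj X Z)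
      (hYZ : (grassmannGraph ξ (m + 1)).Adj Y Z) (hZA : (grassmannGraph ξ (m + 1)).Adj Z A)
      (hZB : (grassmannGraph ξ (m + 1)).Adj Z B) : Z.1 ⊓ X.1 = A.1 ⊓ X.1 := by
    rcases inf_eq_or_inf_eq_of_adj hd hXZ.symm hYZ.symm hXA.symm hYA.symm hZA with hA | hA
    · exact hA
    rcases inf_eq_or_inf_eq_of_adj hd hXZ.symm hYZ.symm hXB.symm hYB.symm hZB with hB | hB
    · exact hB.trans h.symm
    · exact absurd (hA.symm.trans hB) hY
  exact hnadj (adj_of_inf_eq hd hXP.symm hYP.symm hXQ.symm hYQ.symm hne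
    ((htrace hXP hYP hPQ.1.1 hPQ.2.1).trans (htrace hXQ hYQ hPQ.1.2 hPQ.2.2).symm))

end Distant

section Near

/-- The graph on `(T-R)_{m+1}` in which two elements are joined when their intersection or their
sum is in `T-R`, of the dimension prescribed by adjacency; adjacency requires both. -/
def nearGraph (ξ : BilinForm F V) (m : ℕ) : SimpleGraph (TR ξ (m + 1)) where
  Adj X Y := X ≠ Y ∧ (IsTR ξ m (X.1 ⊓ Y.1) ∨ IsTR ξ (m + 2) (X.1 ⊔ Y.1))
  symm := ⟨fun X Y ⟨hne, h⟩ => ⟨hne.symm, by rwa [inf_comm, sup_comm]⟩⟩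
  loopless := ⟨fun _ h => h.1 rfl⟩

variable [FiniteDimensional F V] {X Y P : TR ξ (m + 1)}

theorem nearGraph_adj_of_common (h : finrank F ↥(X.1 ⊓ Y.1) = m) (hne : X ≠ Y)
    (hPX : Adj ξ (m + 1) P X) (hPY : Adj ξ (m + 1) P Y) : (nearGraph ξ m).Adj X Y := by
  obtain ⟨-, hX, -⟩ := adj_iff.1 hPX
  obtain ⟨hnePY, hY, hB⟩ := adj_iff.1 hPY
  refine ⟨hne, ?_⟩
  by_cases htrace : P.1 ⊓ X.1 = P.1 ⊓ Y.1
  · left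
    rwa [TR.inf_eq hne hX.1 inf_le_right (htrace.trans_le inf_le_right)]
  · right
    have hP : P.1 ≤ X.1 ⊔ Y.1 := by
      rw [← sup_eq_of_finrank inf_le_left inf_le_left (by rw [hX.1, P.finrank_eq])
        (by rw [hX.1, hY.1]) htrace]
      exact sup_le_sup inf_le_right inf_le_right
    have := X.finrank_sup_add_finrank_inf Y
    rwa [← TR.sup_eq hnePY (by omega) hP le_sup_right]

variable [Nontrivial Fˣ]

theorem IsTR.hasDiamond_adjoin (halt : ξ.IsAlt) (hnd : ξ.Nondegenerate) (hm : Even m)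
    {H : Submodule F V} (hH : IsTR ξ m H) {y z : V} (hy : y ∈ ξ.orthogonal H) (hy0 : y ≠ 0)
    (hz : z ∈ ξ.orthogonal H) (hz0 : z ≠ 0) (hyz : ξ y z = 0)
    (hne : hH.adjoin halt hm hy hy0 ≠ hH.adjoin halt hm hz hz0) :
    HasDiamond (grassmannGraph ξ (m + 1)) (hH.adjoin halt hm hy hy0)
      (hH.adjoin halt hm hz hz0) := by
  have hzy : ξ z y = 0 := halt.isRefl _ _ hyz
  have hspan : ∀ c : F, c • z ≠ y := by
    rwa [Ne, hH.adjoin_eq_adjoin_iff halt hm hy hy0 hz hz0, mem_span_singleton,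
      not_exists] at hne
  have hind : LinearIndependent F ![z, y] := (LinearIndependent.pair_iff' hz0).2 hspan
  obtain ⟨d, hd, hcoord⟩ := ((isRegular_orthogonal_iff halt.isRefl hnd).2
    (hH.isRegular hm)).exists_forall_apply_eq halt hnd hind
      (by simpa [Fin.forall_fin_two] using ⟨hz, hy⟩) ![1, 1]
  obtain ⟨hzd, hyd⟩ : ξ z d = 1 ∧ ξ y d = 1 := by simpa [Fin.forall_fin_two] using hcoord
  have hdz : ξ d z = -1 := by rw [← halt.neg_eq, hzd]
  have hdy : ξ d y = -1 := by rw [← halt.neg_eq, hyd]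
  obtain ⟨c, hc⟩ := exists_ne (1 : Fˣ)
  have hc1 : -(c : F) + 1 ≠ 0 := by simpa [neg_add_eq_zero] using hc
  have hmem : d ∉ span F {d + y - z} := by
    rw [mem_span_singleton]
    rintro ⟨a, ha⟩
    have ha1 : a = 1 := by simpa [hyd, halt y, hyz] using congrArg (ξ y) ha
    rw [ha1, one_smul, add_sub_assoc, add_eq_left] at ha
    exact hspan 1 (by rw [one_smul, sub_eq_zero.1 ha])
  have hne0 {w : V} (hw : ξ y w = 1) : w ≠ 0 := by
    rintro rfl
    simp at hw
  have ha : d + y ∈ ξ.orthogonal H := add_mem hd hy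
  have hb : d + c.1 • y ∈ ξ.orthogonal H := add_mem hd (smul_mem _ _ hy)
  have hq : d + y - z ∈ ξ.orthogonal H := sub_mem ha hz
  have ha0 : d + y ≠ 0 := hne0 (by simp [hyd, halt y])
  have hb0 : d + c.1 • y ≠ 0 := hne0 (by simp [hyd, halt y])
  have hq0 : d + y - z ≠ 0 := hne0 (by simp [hyd, halt y, hyz])
  refine ⟨hH.adjoin halt hm ha ha0, hH.adjoin halt hm hb hb0,
    hH.adjoin halt hm hd (hne0 hyd), hH.adjoin halt hm hq hq0, ?_⟩
  simp [Set.insert_subset_iff, SimpleGraph.mem_commonNeighbors, grassmannGraph,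
    hH.adj_adjoin_iff halt hm, hH.adjoin_eq_adjoin_iff halt hm, hyd, hzd, hdy, hdz, hyz, hzy,
    halt y, halt z, halt d, hc1, hmem]

theorem IsTR.hasDiamond_of_le (halt : ξ.IsAlt) (hnd : ξ.Nondegenerate) {H : Submodule F V}
    (hH : IsTR ξ m H) (hHX : H ≤ X.1) (hHY : H ≤ Y.1) (hne : X ≠ Y)
    (hXY : ¬ Adj ξ (m + 1) X Y) : HasDiamond (grassmannGraph ξ (m + 1)) X Y := by
  have hm : Even m := by
    by_contra hm
    exact hXY (adj_of_even halt hnd (Nat.even_add_one.2 hm) hne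
      (by rw [TR.inf_eq hne hH.1 hHX hHY, hH.1]))
  obtain ⟨y, hy, hy0, rfl⟩ := hH.exists_eq_adjoin halt hm hHX
  obtain ⟨z, hz, hz0, rfl⟩ := hH.exists_eq_adjoin halt hm hHY
  rw [hH.adj_adjoin_iff halt hm hy hy0 hz hz0, not_not] at hXY
  exact hH.hasDiamond_adjoin halt hnd hm hy hy0 hz hz0 hXY hne

theorem IsTR.hasDiamond_of_ge (halt : ξ.IsAlt) (hnd : ξ.Nondegenerate) {B : Submodule F V}
    (hB : IsTR ξ (m + 2) B) (hXB : X.1 ≤ B) (hYB : Y.1 ≤ B) (hne : X ≠ Y)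
    (hXY : ¬ Adj ξ (m + 1) X Y) : HasDiamond (grassmannGraph ξ (m + 1)) X Y := by
  obtain ⟨m', hm'⟩ : ∃ m', (m + 1) + (m' + 1) = finrank F V :=
    ⟨finrank F V - (m + 2), by have := hB.1; have := B.finrank_le; omega⟩
  rw [← hasDiamond_map_iff (orthogonalIso halt hnd hm')]
  exact ((isTR_orthogonal_iff (m := m + 2) halt hnd (by omega)).2 hB).hasDiamond_of_le halt hnd
    (BilinForm.orthogonal_le hXB) (BilinForm.orthogonal_le hYB)
    ((orthogonalIso halt hnd hm').injective.ne hne)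
    ((orthogonalIso halt hnd hm').map_adj_iff.not.2 hXY)

theorem nearGraph_adj_iff (halt : ξ.IsAlt) (hnd : ξ.Nondegenerate) :
    (nearGraph ξ m).Adj X Y ↔ X ≠ Y ∧ (Adj ξ (m + 1) X Y ∨
      HasDiamond (grassmannGraph ξ (m + 1)) X Y) := by
  constructor
  · rintro ⟨hne, hH | hB⟩
    · exact ⟨hne, or_iff_not_imp_left.2 (hH.hasDiamond_of_le halt hnd inf_le_left inf_le_right hne)⟩
    · exact ⟨hne, or_iff_not_imp_left.2 (hB.hasDiamond_of_ge halt hnd le_sup_left le_sup_right hne)⟩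
  · rintro ⟨hne, hadj | hdiamond⟩
    · exact ⟨hne, .inl (adj_iff.1 hadj).2.1⟩
    · have hrank : finrank F ↥(X.1 ⊓ Y.1) = m := (TR.finrank_inf_le hne).eq_of_not_lt
        fun hd => not_hasDiamond_of_finrank_inf_lt hd hdiamond
      obtain ⟨A, _, _, _, hXY, -⟩ := hdiamond
      obtain ⟨hXA, hYA⟩ := SimpleGraph.mem_commonNeighbors _ |>.1 (hXY (Set.mem_insert A _))
      exact nearGraph_adj_of_common hrank hne hXA.symm hYA.symm

/-- An isomorphism of adjacency graphs is also one of nearness graphs, by `nearGraph_adj_iff`. -/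
def nearIso (halt : ξ.IsAlt) (hnd : ξ.Nondegenerate)
    (f : grassmannGraph ξ (m + 1) ≃g grassmannGraph ξ (m' + 1)) :
    nearGraph ξ m ≃g nearGraph ξ m' where
  toEquiv := f.toEquiv
  map_rel_iff' := by
    intro X Y
    rw [nearGraph_adj_iff halt hnd, nearGraph_adj_iff halt hnd]
    exact and_congr f.injective.ne_iff (or_congr f.map_adj_iff (hasDiamond_map_iff f))

end Near

/-! ### Neighbours inside stars and pencils -/

section Pencils

theorem exists_mem_notMem_notMem {B Z Z' : Submodule F V} (hZ : ¬ B ≤ Z) (hZ' : ¬ B ≤ Z') :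
    ∃ w ∈ B, w ∉ Z ∧ w ∉ Z' := by
  have h := AddSubgroupClass.subset_union.not.2 (not_or.2 ⟨hZ, hZ'⟩)
  simpa [Set.not_subset] using h

theorem IsRegular.exists_notMem_apply_ne_zero (hrefl : ξ.IsRefl) {U B Z : Submodule F V}
    (hU : IsRegular ξ U) {y : V} (hy : y ∈ U) (h0 : y ≠ 0) (hUB : U ≤ B) (hBZ : ¬ B ≤ Z) :
    ∃ w ∈ B, w ∉ Z ∧ ξ y w ≠ 0 := by
  obtain ⟨z, hz, hyz⟩ := hU.exists_apply_ne_zero hrefl hy h0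
  obtain ⟨w, hwB, hwZ, hw⟩ := exists_mem_notMem_notMem hBZ
    fun h => hyz (mem_orthogonal_span_singleton_iff.1 (h (hUB hz)))
  exact ⟨w, hwB, hwZ, fun h => hw (mem_orthogonal_span_singleton_iff.2 h)⟩

variable [FiniteDimensional F V] {H B Z : Submodule F V} {X : TR ξ (m + 1)}

theorem IsTR.sup_span_of_not_even (halt : ξ.IsAlt) (hm : ¬ Even m) (hH : IsTR ξ m H) {r w : V}
    (hr : r ∈ rad ξ H) (hrw : ξ r w ≠ 0) : IsTR ξ (m + 1) (H ⊔ span F {w}) := by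
  have hw : w ∉ H := fun h => hrw (halt.isRefl _ _ (hr.2 w h))
  exact (isTR_iff_of_even (Nat.even_add_one.2 hm)).2
    ⟨by rw [finrank_sup_span_singleton hw, hH.1],
      (hH.isTangential hm).isRegular_sup_span halt.isRefl hr hrw⟩

theorem IsTR.exists_adj_of_even (halt : ξ.IsAlt) (hm : Even m) (hH : IsTR ξ m H) (hHX : H ≤ X.1)
    (hXB : X.1 ≤ B) (hB : IsRegular ξ B) (hXZ : X.1 ≤ Z) (hBZ : ¬ B ≤ Z) :
    ∃ W : TR ξ (m + 1), H ≤ W.1 ∧ W.1 ≤ B ∧ Adj ξ (m + 1) X W ∧ ¬ W.1 ≤ Z := by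
  obtain ⟨y, hy, hy0, rfl⟩ := hH.exists_eq_adjoin halt hm hHX
  obtain ⟨w, hwB, hwZ, hyw⟩ := hB.exists_notMem_apply_ne_zero halt.isRefl
    (hXB (hH.mem_adjoin halt hm hy hy0)) hy0 le_rfl hBZ
  obtain ⟨h, hh, d, hd, rfl⟩ := (hH.isRegular hm).exists_add_eq halt.isRefl w
  rw [map_add, halt.isRefl _ _ (hy h hh), zero_add] at hyw
  have hd0 : d ≠ 0 := by
    rintro rfl
    simp at hyw
  refine ⟨hH.adjoin halt hm hd hd0, hH.le_adjoin halt hm hd hd0, ?_,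
    (hH.adj_adjoin_iff halt hm hy hy0 hd hd0).2 hyw, fun hle => hwZ ?_⟩
  · rw [hH.adjoin_le_iff halt hm hd hd0 (hHX.trans hXB)]
    exact (B.add_mem_iff_right (hXB (hHX hh))).1 hwB
  · exact add_mem (hXZ (hHX hh)) (hle (hH.mem_adjoin halt hm hd hd0))

theorem IsTR.exists_adj_of_not_even (halt : ξ.IsAlt) (hnd : ξ.Nondegenerate) (hm : ¬ Even m)
    (hH : IsTR ξ m H) (hHX : H ≤ X.1) (hXB : X.1 ≤ B) (hXZ : X.1 ≤ Z) (hBZ : ¬ B ≤ Z) :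
    ∃ W : TR ξ (m + 1), H ≤ W.1 ∧ W.1 ≤ B ∧ Adj ξ (m + 1) X W ∧ ¬ W.1 ≤ Z := by
  have hm' : Even (m + 1) := Nat.even_add_one.2 hm
  obtain ⟨r, hr, hr0⟩ := (hH.isTangential hm).exists_mem_rad_ne_zero
  obtain ⟨w, hwB, hwZ, hrw⟩ := (X.2.isRegular hm').exists_notMem_apply_ne_zero halt.isRefl
    (hHX hr.1) hr0 hXB hBZ
  let W : TR ξ (m + 1) := ⟨H ⊔ span F {w}, hH.sup_span_of_not_even halt hm hr hrw⟩
  have hWZ : ¬ W.1 ≤ Z := fun hle => hwZ (hle (mem_sup_right (mem_span_singleton_self w)))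
  have hne : X ≠ W := fun h => hWZ (h ▸ hXZ)
  refine ⟨W, le_sup_left, sup_le (hHX.trans hXB) ((span_singleton_le_iff_mem _ _).2 hwB),
    adj_of_even halt hnd hm' hne ?_, hWZ⟩
  rw [TR.inf_eq hne hH.1 hHX le_sup_left, hH.1]

theorem IsTR.exists_adj (halt : ξ.IsAlt) (hnd : ξ.Nondegenerate) (hH : IsTR ξ m H)
    (hHX : H ≤ X.1) (hXB : X.1 ≤ B) (hB : Even m → IsRegular ξ B) (hXZ : X.1 ≤ Z)
    (hBZ : ¬ B ≤ Z) :
    ∃ W : TR ξ (m + 1), H ≤ W.1 ∧ W.1 ≤ B ∧ Adj ξ (m + 1) X W ∧ ¬ W.1 ≤ Z := by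
  by_cases hm : Even m
  · exact hH.exists_adj_of_even halt hm hHX hXB (hB hm) hXZ hBZ
  · exact hH.exists_adj_of_not_even halt hnd hm hHX hXB hXZ hBZ

theorem IsTR.exists_ge (halt : ξ.IsAlt) (hnd : ξ.Nondegenerate) (hH : IsTR ξ m H)
    (hm : m < finrank F V) : ∃ X : TR ξ (m + 1), H ≤ X.1 := by
  by_cases he : Even m
  · have hrank := finrank_add_finrank_orthogonal hnd H
    have hbot : ξ.orthogonal H ≠ ⊥ := fun h => by
      rw [h, finrank_bot, hH.1] at hrank
      omega
    obtain ⟨y, hy, hy0⟩ := exists_mem_ne_zero_of_ne_bot hbot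
    exact ⟨hH.adjoin halt he hy hy0, hH.le_adjoin halt he hy hy0⟩
  · obtain ⟨r, hr, hr0⟩ := (hH.isTangential he).exists_mem_rad_ne_zero
    obtain ⟨w, -, hw⟩ := (isRegular_top hnd).exists_apply_ne_zero halt.isRefl (mem_top (x := r)) hr0
    exact ⟨⟨_, hH.sup_span_of_not_even halt he hr hw⟩, le_sup_left⟩

theorem IsTR.exists_le (halt : ξ.IsAlt) (hnd : ξ.Nondegenerate) (hB : IsTR ξ (m + 1) B) :
    ∃ H : TR ξ m, H.1 ≤ B := by
  obtain ⟨m', hm'⟩ : ∃ m', m + 1 + m' = finrank F V :=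
    ⟨_, hB.1 ▸ finrank_add_finrank_orthogonal hnd B⟩
  obtain ⟨X, hX⟩ := ((isTR_orthogonal_iff halt hnd hm').2 hB).exists_ge halt hnd (by omega)
  refine ⟨⟨ξ.orthogonal X.1, (isTR_orthogonal_iff halt hnd (by omega)).2 X.2⟩, ?_⟩
  rw [← orthogonal_le_orthogonal_iff halt.isRefl hnd,
    BilinForm.orthogonal_orthogonal hnd halt.isRefl]
  exact hX

end Pencils

/-! ### Stars and tops are the maximal cliques of the nearness graph -/

section Blocks

/-- The star of all elements of `(T-R)_{m+1}` containing `H`. -/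
def star (ξ : BilinForm F V) (m : ℕ) (H : Submodule F V) : Set (TR ξ (m + 1)) :=
  {U | H ≤ U.1}

/-- The top of all elements of `(T-R)_{m+1}` contained in `B`. -/
def top (ξ : BilinForm F V) (m : ℕ) (B : Submodule F V) : Set (TR ξ (m + 1)) :=
  {U | U.1 ≤ B}

/-- `C` is the star of an element of `(T-R)_m`. -/
def IsStar (C : Set (TR ξ (m + 1))) : Prop :=
  ∃ H, IsTR ξ m H ∧ C = star ξ m H

/-- `C` is the top of an element of `(T-R)_{m+2}`. -/
def IsTop (C : Set (TR ξ (m + 1))) : Prop :=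
  ∃ B, IsTR ξ (m + 2) B ∧ C = top ξ m B

/-- A maximal clique of the nearness graph containing an adjacent pair. Blocks are defined in terms
of adjacency alone, and they turn out to be exactly the stars and the tops. -/
def IsBlock (C : Set (TR ξ (m + 1))) : Prop :=
  Maximal (nearGraph ξ m).IsClique C ∧ ∃ X ∈ C, ∃ Y ∈ C, Adj ξ (m + 1) X Y

theorem maximal_isClique_iff {α : Type*} {G : SimpleGraph α} {C : Set α} :
    Maximal G.IsClique C ↔ G.IsClique C ∧ ∀ z, (∀ x ∈ C, z ≠ x → G.Adj z x) → z ∈ C := by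
  rw [Set.maximal_iff_forall_insert fun _ _ h hle => h.subset hle]
  refine and_congr_right fun hC => forall_congr' fun z => ?_
  rw [SimpleGraph.isClique_insert, not_imp_comm, not_not, and_iff_right hC]

theorem maximal_isClique_image {α β : Type*} {G : SimpleGraph α} {G' : SimpleGraph β} (f : G ≃g G')
    {C : Set α} (hC : Maximal G.IsClique C) : Maximal G'.IsClique (f '' C) := by
  rw [maximal_isClique_iff] at hC ⊢
  refine ⟨?_, fun z hz => ⟨f.symm z, hC.2 _ fun x hx hne => ?_, f.apply_symm_apply z⟩⟩
  · rintro _ ⟨x, hx, rfl⟩ _ ⟨y, hy, rfl⟩ hne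
    exact f.map_adj_iff.2 (hC.1 hx hy (ne_of_apply_ne f hne))
  · rw [← f.map_adj_iff, f.apply_symm_apply]
    exact hz _ ⟨x, hx, rfl⟩ fun h => hne (by rw [h, f.symm_apply_apply])

variable [FiniteDimensional F V]

theorem IsStar.eq_of_mem {C C' : Set (TR ξ (m + 1))} (hC : IsStar C) (hC' : IsStar C')
    {X Y : TR ξ (m + 1)} (hne : X ≠ Y) (hX : X ∈ C) (hY : Y ∈ C) (hX' : X ∈ C') (hY' : Y ∈ C') :
    C = C' := by
  obtain ⟨H, hH, rfl⟩ := hC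
  obtain ⟨H', hH', rfl⟩ := hC'
  rw [← TR.inf_eq hne hH.1 hX hY, TR.inf_eq hne hH'.1 hX' hY']

theorem IsTop.eq_of_mem {C C' : Set (TR ξ (m + 1))} (hC : IsTop C) (hC' : IsTop C')
    {X Y : TR ξ (m + 1)} (hne : X ≠ Y) (hX : X ∈ C) (hY : Y ∈ C) (hX' : X ∈ C') (hY' : Y ∈ C') :
    C = C' := by
  obtain ⟨B, hB, rfl⟩ := hC
  obtain ⟨B', hB', rfl⟩ := hC'
  rw [← TR.sup_eq hne hB.1 hX hY, TR.sup_eq hne hB'.1 hX' hY']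

theorem isClique_star {H : Submodule F V} (hH : IsTR ξ m H) :
    (nearGraph ξ m).IsClique (star ξ m H) :=
  fun X hX Y hY hne => ⟨hne, .inl (by rwa [TR.inf_eq hne hH.1 hX hY])⟩

theorem isClique_top {B : Submodule F V} (hB : IsTR ξ (m + 2) B) :
    (nearGraph ξ m).IsClique (top ξ m B) :=
  fun X hX Y hY hne => ⟨hne, .inr (by rwa [TR.sup_eq hne hB.1 hX hY])⟩

theorem adj_le_nearGraph {X Y : TR ξ (m + 1)} (h : Adj ξ (m + 1) X Y) : (nearGraph ξ m).Adj X Y :=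
  ⟨h.1, .inl (adj_iff.1 h).2.1⟩

theorem finrank_inf_of_near {X Y : TR ξ (m + 1)} (h : (nearGraph ξ m).Adj X Y) :
    finrank F ↥(X.1 ⊓ Y.1) = m := by
  have := X.finrank_sup_add_finrank_inf Y
  rcases h.2 with hH | hB
  · exact hH.1
  · have := hB.1
    omega

theorem inf_le_or_le_sup_of_near {X Y Z : TR ξ (m + 1)} (h : (nearGraph ξ m).Adj X Y)
    (hX : (nearGraph ξ m).Adj Z X) (hY : (nearGraph ξ m).Adj Z Y) :
    X.1 ⊓ Y.1 ≤ Z.1 ∨ Z.1 ≤ X.1 ⊔ Y.1 := by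
  have hrankX := finrank_inf_of_near hX
  have hrankY := finrank_inf_of_near hY
  by_cases htrace : Z.1 ⊓ X.1 = Z.1 ⊓ Y.1
  · left
    rw [TR.inf_eq h.1 hrankX inf_le_right (htrace.trans_le inf_le_right)]
    exact inf_le_left
  · right
    rw [← sup_eq_of_finrank inf_le_left inf_le_left (by rw [hrankX, Z.finrank_eq])
      (by rw [hrankX, hrankY]) htrace]
    exact sup_le_sup inf_le_right inf_le_right

theorem le_of_near_star (halt : ξ.IsAlt) (hnd : ξ.Nondegenerate) (hm : m + 2 < finrank F V)
    {H : Submodule F V} (hH : IsTR ξ m H) {Z : TR ξ (m + 1)}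
    (hZ : ∀ X ∈ star ξ m H, Z ≠ X → (nearGraph ξ m).Adj Z X) : H ≤ Z.1 := by
  by_contra hHZ
  have hnear : ∀ X ∈ star ξ m H, (nearGraph ξ m).Adj Z X :=
    fun X hX => hZ X hX fun h => hHZ (h ▸ hX)
  have hnotTop {U : Submodule F V} (hU : finrank F U < finrank F V) : ¬ ⊤ ≤ U := fun h => by
    rw [top_le_iff.1 h, finrank_top] at hU
    exact hU.false
  obtain ⟨X, hX⟩ := hH.exists_ge halt hnd (by omega)
  obtain ⟨W, hW, -, hXW, -⟩ := hH.exists_adj halt hnd hX le_top (fun _ => isRegular_top hnd)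
    le_rfl (hnotTop (by rw [X.finrank_eq]; omega))
  have hrank : finrank F ↥(X.1 ⊔ W.1) = m + 2 := (adj_iff.1 hXW).2.2.1
  obtain ⟨W', hW', -, hXW', hnle⟩ := hH.exists_adj halt hnd hX le_top
    (fun _ => isRegular_top hnd) (le_sup_left : X.1 ≤ X.1 ⊔ W.1) (hnotTop (by omega))
  have hle {Y : TR ξ (m + 1)} (hY : H ≤ Y.1) (hXY : Adj ξ (m + 1) X Y) : Z.1 ≤ X.1 ⊔ Y.1 := by
    refine (inf_le_or_le_sup_of_near (adj_le_nearGraph hXY) (hnear X hX)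
      (hnear Y hY)).resolve_left ?_
    rwa [TR.inf_eq hXY.1 hH.1 hX hY]
  have hinf : (X.1 ⊔ W.1) ⊓ (X.1 ⊔ W'.1) = X.1 := inf_eq_of_finrank le_sup_left le_sup_left
    (by rw [hrank, X.finrank_eq]) (by rw [hrank, (adj_iff.1 hXW').2.2.1])
    fun h => hnle (h ▸ le_sup_right)
  exact (hnear X hX).ne (TR.eq_of_le (hinf ▸ le_inf (hle hW hXW) (hle hW' hXW')))

theorem isBlock_star (halt : ξ.IsAlt) (hnd : ξ.Nondegenerate) (hm : m + 2 < finrank F V)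
    {H : Submodule F V} (hH : IsTR ξ m H) : IsBlock (star ξ m H) := by
  refine ⟨maximal_isClique_iff.2 ⟨isClique_star hH, fun Z hZ => le_of_near_star halt hnd hm hH hZ⟩,
    ?_⟩
  obtain ⟨X, hX⟩ := hH.exists_ge halt hnd (by omega)
  obtain ⟨W, hW, -, hXW, -⟩ := hH.exists_adj halt hnd hX le_top (fun _ => isRegular_top hnd)
    le_rfl fun h => by
      have := finrank_mono h
      rw [finrank_top, X.finrank_eq] at this
      omega
  exact ⟨X, hX, W, hW, hXW⟩

theorem star_injective (halt : ξ.IsAlt) (hnd : ξ.Nondegenerate) (hm : m + 2 < finrank F V)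
    {H H' : Submodule F V} (hH : IsTR ξ m H) (hH' : IsTR ξ m H')
    (h : star ξ m H = star ξ m H') : H = H' := by
  obtain ⟨-, X, hX, Y, hY, hXY⟩ := isBlock_star halt hnd hm hH
  have mem {U : TR ξ (m + 1)} (hU : U ∈ star ξ m H) : U ∈ star ξ m H' := h ▸ hU
  rw [← TR.inf_eq hXY.1 hH.1 hX hY, TR.inf_eq hXY.1 hH'.1 (mem hX) (mem hY)]

theorem star_ne_top (halt : ξ.IsAlt) (hnd : ξ.Nondegenerate) (hm : m + 2 < finrank F V)
    {H B : Submodule F V} (hH : IsTR ξ m H) (hB : finrank F B = m + 2) :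
    star ξ m H ≠ top ξ m B := by
  intro h
  obtain ⟨X, hX⟩ := hH.exists_ge halt hnd (by omega)
  have hXB : X ∈ top ξ m B := h ▸ hX
  obtain ⟨W, hW, -, -, hnle⟩ := hH.exists_adj halt hnd hX le_top
    (fun _ => isRegular_top hnd) hXB fun hle => by
      rw [top_le_iff.1 hle, finrank_top] at hB
      omega
  exact hnle (h ▸ hW : W ∈ top ξ m B)

theorem exists_ne_mem_star_inter_top (halt : ξ.IsAlt) (hnd : ξ.Nondegenerate) {H B : Submodule F V}
    (hH : IsTR ξ m H) (hB : IsTR ξ (m + 2) B) {X : TR ξ (m + 1)} (hHX : H ≤ X.1) (hXB : X.1 ≤ B) :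
    ∃ W, X ≠ W ∧ H ≤ W.1 ∧ W.1 ≤ B := by
  obtain ⟨W, hW, hWB, hadj, -⟩ := hH.exists_adj halt hnd hHX hXB
    (fun he => hB.isRegular (he.add even_two)) le_rfl fun h => by
      have := finrank_mono h
      rw [hB.1, X.finrank_eq] at this
      omega
  exact ⟨W, hadj.1, hW, hWB⟩

theorem image_orthogonalIso_top (halt : ξ.IsAlt) (hnd : ξ.Nondegenerate)
    (h : (m + 1) + (m' + 1) = finrank F V) (B : Submodule F V) :
    orthogonalIso halt hnd h '' top ξ m B = star ξ m' (ξ.orthogonal B) := by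
  rw [RelIso.image_eq_preimage_symm]
  ext U
  change ξ.orthogonal U.1 ≤ B ↔ ξ.orthogonal B ≤ U.1
  rw [← orthogonal_le_orthogonal_iff halt.isRefl hnd,
    BilinForm.orthogonal_orthogonal hnd halt.isRefl]

theorem image_orthogonalIso_star (halt : ξ.IsAlt) (hnd : ξ.Nondegenerate)
    (h : (m + 1) + (m' + 1) = finrank F V) (H : Submodule F V) :
    orthogonalIso halt hnd h '' star ξ m H = top ξ m' (ξ.orthogonal H) := by
  rw [RelIso.image_eq_preimage_symm]
  ext U
  exact le_orthogonal_comm halt.isRefl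

theorem subset_top_of_isClique {C : Set (TR ξ (m + 1))} (hC : (nearGraph ξ m).IsClique C)
    {X Y Z : TR ξ (m + 1)} (hX : X ∈ C) (hY : Y ∈ C) (hZ : Z ∈ C) (hXY : Adj ξ (m + 1) X Y)
    (hnle : ¬ X.1 ⊓ Y.1 ≤ Z.1) : C ⊆ top ξ m (X.1 ⊔ Y.1) := by
  have hnear := adj_le_nearGraph hXY
  have hZB : Z.1 ≤ X.1 ⊔ Y.1 := (inf_le_or_le_sup_of_near hnear
    (hC hZ hX fun h => hnle (h ▸ inf_le_left))
    (hC hZ hY fun h => hnle (h ▸ inf_le_right))).resolve_left hnle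
  intro W hW
  by_contra hWB
  have hne {U : TR ξ (m + 1)} (hU : U.1 ≤ X.1 ⊔ Y.1) : W ≠ U := fun h => hWB (h ▸ hU)
  have hHW : X.1 ⊓ Y.1 ≤ W.1 := (inf_le_or_le_sup_of_near hnear
    (hC hW hX (hne le_sup_left)) (hC hW hY (hne le_sup_right))).resolve_right hWB
  have hlt : finrank F ↥(W.1 ⊓ (X.1 ⊔ Y.1)) < m + 1 :=
    (finrank_lt_finrank_of_lt (inf_lt_left.2 hWB)).trans_eq W.finrank_eq
  have hH : X.1 ⊓ Y.1 = W.1 ⊓ (X.1 ⊔ Y.1) :=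
    eq_of_le_of_finrank_le (le_inf hHW (inf_le_left.trans le_sup_left))
      (by rw [finrank_inf_of_near hnear]; omega)
  have hWZ : W.1 ⊓ Z.1 = X.1 ⊓ Y.1 := eq_of_le_of_finrank_eq
    ((inf_le_inf_left _ hZB).trans_eq hH.symm)
    (by rw [finrank_inf_of_near (hC hW hZ (hne hZB)), finrank_inf_of_near hnear])
  exact hnle (hWZ.ge.trans inf_le_right)

theorem IsBlock.isStar_or_isTop {C : Set (TR ξ (m + 1))} (hC : IsBlock C) :
    IsStar C ∨ IsTop C := by
  obtain ⟨hmax, X, hX, Y, hY, hXY⟩ := hC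
  obtain ⟨-, hH, hB⟩ := adj_iff.1 hXY
  by_cases hall : C ⊆ star ξ m (X.1 ⊓ Y.1)
  · exact .inl ⟨_, hH, hmax.eq_of_subset (isClique_star hH) hall⟩
  · obtain ⟨Z, hZ, hnle⟩ := Set.not_subset.1 hall
    exact .inr ⟨_, hB, hmax.eq_of_subset (isClique_top hB)
      (subset_top_of_isClique hmax.prop hX hY hZ hXY hnle)⟩

variable [Nontrivial Fˣ] (halt : ξ.IsAlt) (hnd : ξ.Nondegenerate)
include halt hnd

theorem IsBlock.image (f : grassmannGraph ξ (m + 1) ≃g grassmannGraph ξ (m' + 1))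
    {C : Set (TR ξ (m + 1))} (hC : IsBlock C) : IsBlock (f '' C) := by
  obtain ⟨hmax, X, hX, Y, hY, hXY⟩ := hC
  exact ⟨maximal_isClique_image (nearIso halt hnd f) hmax, f X, ⟨X, hX, rfl⟩, f Y, ⟨Y, hY, rfl⟩,
    f.map_adj_iff.2 hXY⟩

theorem isBlock_top (hm : 1 ≤ m) {B : Submodule F V} (hB : IsTR ξ (m + 2) B) :
    IsBlock (top ξ m B) := by
  obtain ⟨m', hm'⟩ : ∃ m', (m + 1) + (m' + 1) = finrank F V :=
    ⟨finrank F V - (m + 2), by have := hB.1; have := B.finrank_le; omega⟩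
  let D := orthogonalIso halt hnd hm'
  have h : IsBlock (D '' top ξ m B) := by
    rw [image_orthogonalIso_top]
    exact isBlock_star halt hnd (by omega)
      ((isTR_orthogonal_iff (m := m + 2) halt hnd (by omega)).2 hB)
  exact D.toEquiv.symm_image_image (top ξ m B) ▸ h.image halt hnd D.symm

theorem isStar_image_star_iff_isTop_image_top (hm1 : 1 ≤ m) (hm : m + 2 < finrank F V)
    (f : grassmannGraph ξ (m + 1) ≃g grassmannGraph ξ (m' + 1)) {H B : Submodule F V}
    (hH : IsTR ξ m H) (hB : IsTR ξ (m + 2) B) {X : TR ξ (m + 1)} (hHX : H ≤ X.1) (hXB : X.1 ≤ B) :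
    IsStar (f '' star ξ m H) ↔ IsTop (f '' top ξ m B) := by
  obtain ⟨W, hne, hHW, hWB⟩ := exists_ne_mem_star_inter_top halt hnd hH hB hHX hXB
  have hstar := ((isBlock_star halt hnd hm hH).image halt hnd f).isStar_or_isTop
  have htop := ((isBlock_top halt hnd hm1 hB).image halt hnd f).isStar_or_isTop
  have himage : f '' star ξ m H ≠ f '' top ξ m B :=
    f.injective.image_injective.ne (star_ne_top halt hnd hm hH hB.1)
  have mem {C : Set (TR ξ (m + 1))} {U : TR ξ (m + 1)} (hU : U ∈ C) : f U ∈ f '' C :=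
    Set.mem_image_of_mem f hU
  exact ⟨fun h => htop.resolve_left fun h' => himage (h.eq_of_mem h' (f.injective.ne hne)
      (mem hHX) (mem hHW) (mem hXB) (mem hWB)),
    fun h => hstar.resolve_right fun h' => himage (h'.eq_of_mem h (f.injective.ne hne)
      (mem hHX) (mem hHW) (mem hXB) (mem hWB))⟩

end Blocks

/-! ### Connectivity -/

section Connectivity

/-- `H` and `K` are contained in a common element of `(T-R)_{k+1}`. -/
def Joined (ξ : BilinForm F V) (k : ℕ) (H K : TR ξ k) : Prop :=
  ∃ X : TR ξ (k + 1), H.1 ≤ X.1 ∧ K.1 ≤ X.1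

variable [FiniteDimensional F V] (halt : ξ.IsAlt) (hnd : ξ.Nondegenerate)
include halt hnd

theorem TR.exists_reachable_mem (hm : Even (m + 1)) (W : TR ξ (m + 1)) {a u : V} (ha : a ∈ W.1)
    (hau : ξ a u ≠ 0) :
    ∃ W' : TR ξ (m + 1), (grassmannGraph ξ (m + 1)).Reachable W W' ∧
      W.1 ⊓ ξ.orthogonal (span F {a}) ≤ W'.1 ∧ u ∈ W'.1 := by
  have ha0 : a ≠ 0 := by
    rintro rfl
    simp at hau
  set H := W.1 ⊓ ξ.orthogonal (span F {a}) with hH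
  have hrank : finrank F H = m := by
    obtain ⟨w, hw, haw⟩ := (W.2.isRegular hm).exists_apply_ne_zero halt.isRefl ha ha0
    have hlt := finrank_lt_finrank_of_lt
      (inf_lt_left.2 fun h => haw (mem_orthogonal_span_singleton_iff.1 (h hw)))
    have hmodular := finrank_sup_add_finrank_inf_eq W.1 (ξ.orthogonal (span F {a}))
    have := (W.1 ⊔ ξ.orthogonal (span F {a})).finrank_le
    have := finrank_add_finrank_orthogonal hnd (span F {a})
    rw [finrank_span_singleton ha0] at this
    rw [W.finrank_eq, ← hH] at hlt hmodular
    omega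
  have hHTR : IsTR ξ m H := W.2.of_succ_of_ge halt hnd hm inf_le_left hrank
  have har : a ∈ rad ξ H := ⟨⟨ha, mem_orthogonal_span_singleton_iff.2 (halt a)⟩,
    (le_orthogonal_comm halt.isRefl).1 inf_le_right (mem_span_singleton_self a)⟩
  let W' : TR ξ (m + 1) :=
    ⟨H ⊔ span F {u}, hHTR.sup_span_of_not_even halt (Nat.even_add_one.1 hm) har hau⟩
  refine ⟨W', ?_, le_sup_left, mem_sup_right (mem_span_singleton_self u)⟩
  by_cases hne : W = W'
  · exact hne ▸ .refl W
  · exact SimpleGraph.Adj.reachable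
      (adj_of_even halt hnd hm hne (by rw [TR.inf_eq hne hrank inf_le_left le_sup_left, hrank]))

theorem TR.exists_reachable_inf_lt_of_apply_ne_zero (hm : Even (m + 1)) (X Y : TR ξ (m + 1))
    {a u : V} (ha : a ∈ Y.1) (haD : a ∈ ξ.orthogonal (X.1 ⊓ Y.1)) (hu : u ∈ X.1)
    (hau : ξ a u ≠ 0) :
    ∃ W : TR ξ (m + 1), (grassmannGraph ξ (m + 1)).Reachable Y W ∧ X.1 ⊓ Y.1 < X.1 ⊓ W.1 := by
  obtain ⟨W, hYW, hW, huW⟩ := Y.exists_reachable_mem halt hnd hm ha hau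
  have hD : X.1 ⊓ Y.1 ≤ ξ.orthogonal (span F {a}) :=
    (le_orthogonal_comm halt.isRefl).1 ((span_singleton_le_iff_mem _ _).2 haD)
  refine ⟨W, hYW, SetLike.lt_iff_le_and_exists.2
    ⟨le_inf inf_le_left ((le_inf inf_le_right hD).trans hW), u, mem_inf.2 ⟨hu, huW⟩,
      fun huD => hau (halt.isRefl _ _ (haD u huD))⟩⟩

/-- If a vector of `Y` orthogonal to `D = X ⊓ Y` pairs with a vector of `X`, the latter can be
exchanged into `Y`. Otherwise a preliminary exchange with a vector of `D^⊥` outside `X^⊥` leads to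
this situation. -/
theorem TR.exists_reachable_inf_lt (hm : Even (m + 1)) {X Y : TR ξ (m + 1)} (hne : X ≠ Y) :
    ∃ W : TR ξ (m + 1), (grassmannGraph ξ (m + 1)).Reachable Y W ∧ X.1 ⊓ Y.1 < X.1 ⊓ W.1 := by
  have hrefl := halt.isRefl
  set D := X.1 ⊓ Y.1
  obtain ⟨a, ⟨haY, haD⟩, ha0⟩ : ∃ a ∈ Y.1 ⊓ ξ.orthogonal D, a ≠ 0 := by
    refine exists_mem_ne_zero_of_ne_bot fun h => ?_
    have := finrank_add_finrank_orthogonal hnd D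
    have hmodular := finrank_sup_add_finrank_inf_eq Y.1 (ξ.orthogonal D)
    have := (Y.1 ⊔ ξ.orthogonal D).finrank_le
    have hD : finrank F D ≤ m := TR.finrank_inf_le hne
    rw [h, finrank_bot, Y.finrank_eq] at hmodular
    omega
  by_cases haX : a ∈ ξ.orthogonal X.1
  swap
  · obtain ⟨u, hu, hua⟩ : ∃ u ∈ X.1, ξ u a ≠ 0 := by simpa [BilinForm.mem_orthogonal_iff] using haX
    exact TR.exists_reachable_inf_lt_of_apply_ne_zero halt hnd hm X Y haY haD hu
      fun h => hua (hrefl _ _ h)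
  have haX' : a ∉ X.1 := fun h => (X.2.isRegular hm).notMem haX ha0 h
  obtain ⟨x, hxD, hxX, hxa⟩ := exists_mem_notMem_notMem (B := ξ.orthogonal D)
    (Z := ξ.orthogonal X.1) (Z' := ξ.orthogonal (span F {a}))
    (fun h => hne (TR.eq_of_le
      (((orthogonal_le_orthogonal_iff hrefl hnd).1 h).trans inf_le_right)))
    (fun h => haX' ((span_singleton_le_iff_mem _ _).1
      ((orthogonal_le_orthogonal_iff hrefl hnd).1 h)).1)
  rw [mem_orthogonal_span_singleton_iff] at hxa
  obtain ⟨W, hYW, hW, hxW⟩ := Y.exists_reachable_mem halt hnd hm haY hxa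
  have hDa : D ≤ ξ.orthogonal (span F {a}) :=
    (le_orthogonal_comm hrefl).1 ((span_singleton_le_iff_mem _ _).2 haD)
  have hDW : D ≤ X.1 ⊓ W.1 := le_inf inf_le_left ((le_inf inf_le_right hDa).trans hW)
  rcases hDW.eq_or_lt with heq | hlt
  · obtain ⟨u, hu, hux⟩ : ∃ u ∈ X.1, ξ u x ≠ 0 := by simpa [BilinForm.mem_orthogonal_iff] using hxX
    obtain ⟨W', hWW', hlt⟩ := TR.exists_reachable_inf_lt_of_apply_ne_zero halt hnd hm X W hxW
      (heq ▸ hxD) hu fun h => hux (hrefl _ _ h)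
    exact ⟨W', hYW.trans hWW', heq ▸ hlt⟩
  · exact ⟨W, hYW, hlt⟩

theorem grassmannGraph_preconnected_of_even (hm : Even (m + 1)) :
    (grassmannGraph ξ (m + 1)).Preconnected := by
  intro X Y
  induction h : X.1 ⊓ Y.1 using WellFoundedGT.induction generalizing Y with
  | ind D ih =>
    by_cases hne : X = Y
    · exact hne ▸ .refl X
    · obtain ⟨W, hYW, hlt⟩ := TR.exists_reachable_inf_lt halt hnd hm hne
      exact (ih _ (h ▸ hlt) W rfl).trans hYW.symm

theorem reflTransGen_joined_of_ge (hm : ¬ Even m) {X Y : TR ξ (m + 1)} {H K : TR ξ m}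
    (hH : H.1 ≤ X.1) (hK : K.1 ≤ Y.1) : Relation.ReflTransGen (Joined ξ m) H K := by
  obtain ⟨p⟩ := grassmannGraph_preconnected_of_even halt hnd (Nat.even_add_one.2 hm) X Y
  induction p generalizing H with
  | nil => exact .single ⟨_, hH, hK⟩
  | cons hadj _ ih =>
    exact .head ⟨_, hH, inf_le_left⟩ (ih (H := ⟨_, (adj_iff.1 hadj).2.1⟩) inf_le_right hK)

theorem reflTransGen_joined (hm : m < finrank F V) (H K : TR ξ m) :
    Relation.ReflTransGen (Joined ξ m) H K := by
  by_cases he : Even m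
  · obtain _ | l := m
    · have : H = K := TR.eq_of_le (by rw [finrank_eq_zero.1 H.2.1]; exact bot_le)
      exact this ▸ .refl
    · refine Relation.ReflTransGen.mono (fun X Y hXY => ?_) _ _
        ((SimpleGraph.reachable_iff_reflTransGen H K).1
          (grassmannGraph_preconnected_of_even halt hnd he H K))
      exact ⟨⟨_, (adj_iff.1 hXY).2.2⟩, le_sup_left, le_sup_right⟩
  · obtain ⟨X, hX⟩ := H.2.exists_ge halt hnd hm
    obtain ⟨Y, hY⟩ := K.2.exists_ge halt hnd hm
    exact reflTransGen_joined_of_ge halt hnd he hX hY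

end Connectivity

/-! ### Recovering adjacency from the incidence with the next dimension -/

section Joined

/-- `H`, `K`, `D` are pairwise contained in elements of `(T-R)_{k+1}`, but not all three in a common
one. -/
def IsTriangle (ξ : BilinForm F V) (k : ℕ) (H K D : TR ξ k) : Prop :=
  Joined ξ k H K ∧ Joined ξ k H D ∧ Joined ξ k K D ∧
    ¬ ∃ X : TR ξ (k + 1), H.1 ≤ X.1 ∧ K.1 ≤ X.1 ∧ D.1 ≤ X.1

/-- The adjacency of tangential subspaces in terms of their incidence with the regular subspaces of
the next dimension. If `H ⊓ K` is not regular then the vertices of all triangles on `H`, `K` contain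
it, and on subspaces through `H ⊓ K` failing to be joined is a transitive relation (having the same
radical). -/
def TangentialAdj (ξ : BilinForm F V) (k : ℕ) (H K : TR ξ k) : Prop :=
  ∃ A B C : TR ξ k, IsTriangle ξ k H K A ∧ IsTriangle ξ k H K B ∧ IsTriangle ξ k H K C ∧
    ¬ Joined ξ k A B ∧ ¬ Joined ξ k B C ∧ Joined ξ k A C ∧ A ≠ C

/-- A pair of bijections preserving the inclusions between `(T-R)_k` and `(T-R)_{k+1}`. -/
def PreservesIncidence {k k' : ℕ} (h : TR ξ k ≃ TR ξ k') (f : TR ξ (k + 1) ≃ TR ξ (k' + 1)) :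
    Prop :=
  ∀ H X, (h H).1 ≤ (f X).1 ↔ H.1 ≤ X.1

theorem PreservesIncidence.joined_iff {k k' : ℕ} {h : TR ξ k ≃ TR ξ k'}
    {f : TR ξ (k + 1) ≃ TR ξ (k' + 1)} (hf : PreservesIncidence h f) {H K : TR ξ k} :
    Joined ξ k' (h H) (h K) ↔ Joined ξ k H K := by
  simp only [Joined, f.surjective.exists, hf _ _]

theorem PreservesIncidence.tangentialAdj_iff {k k' : ℕ} {h : TR ξ k ≃ TR ξ k'}
    {f : TR ξ (k + 1) ≃ TR ξ (k' + 1)} (hf : PreservesIncidence h f) {H K : TR ξ k} :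
    TangentialAdj ξ k' (h H) (h K) ↔ TangentialAdj ξ k H K := by
  simp only [TangentialAdj, IsTriangle, h.surjective.exists, f.surjective.exists, hf.joined_iff,
    hf _ _, h.injective.ne_iff]

theorem IsTriangle.ne {k : ℕ} {H K D : TR ξ k} (h : IsTriangle ξ k H K D) : H ≠ K := by
  rintro rfl
  obtain ⟨-, ⟨X, hH, hD⟩, -, hX⟩ := h
  exact hX ⟨X, hH, hH, hD⟩

theorem IsTriangle.ne_left {k : ℕ} {H K D : TR ξ k} (h : IsTriangle ξ k H K D) : H ≠ D := by
  rintro rfl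
  obtain ⟨⟨X, hH, hK⟩, -, -, hX⟩ := h
  exact hX ⟨X, hH, hK, hH⟩

theorem IsTriangle.ne_right {k : ℕ} {H K D : TR ξ k} (h : IsTriangle ξ k H K D) : K ≠ D := by
  rintro rfl
  obtain ⟨⟨X, hH, hK⟩, -, -, hX⟩ := h
  exact hX ⟨X, hH, hK, hK⟩

theorem rad_inf_rad_le_rad_sup (H K : Submodule F V) : rad ξ H ⊓ rad ξ K ≤ rad ξ (H ⊔ K) := by
  rw [rad, rad, rad, orthogonal_sup]
  exact le_inf ((inf_le_left.trans inf_le_left).trans le_sup_left)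
    (inf_le_inf inf_le_right inf_le_right)

variable [FiniteDimensional F V]

theorem Joined.isTR_sup {H K : TR ξ (m + 1)} (h : Joined ξ (m + 1) H K) (hne : H ≠ K) :
    IsTR ξ (m + 2) (H.1 ⊔ K.1) := by
  obtain ⟨X, hH, hK⟩ := h
  rw [TR.sup_eq hne X.finrank_eq hH hK]
  exact X.2

theorem joined_iff_isTR_sup {H K : TR ξ (m + 1)} (hne : H ≠ K) :
    Joined ξ (m + 1) H K ↔ IsTR ξ (m + 2) (H.1 ⊔ K.1) :=
  ⟨fun h => h.isTR_sup hne, fun h => ⟨⟨_, h⟩, le_sup_left, le_sup_right⟩⟩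

theorem adj_iff_joined_of_even (halt : ξ.IsAlt) (hnd : ξ.Nondegenerate) (hm : Even (m + 1))
    {H K : TR ξ (m + 1)} : Adj ξ (m + 1) H K ↔ H ≠ K ∧ Joined ξ (m + 1) H K := by
  refine ⟨fun h => ⟨h.1, (joined_iff_isTR_sup h.1).2 (adj_iff.1 h).2.2⟩, fun ⟨hne, h⟩ => ?_⟩
  exact adj_of_even halt hnd hm hne (finrank_inf_of_near ⟨hne, .inr (h.isTR_sup hne)⟩)

theorem rad_le_of_not_isRegular (hrefl : ξ.IsRefl) {G K : Submodule F V} (hG : ¬ IsRegular ξ G)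
    (hK : IsTangential ξ K) (hGK : G ≤ K) (hrank : finrank F K = finrank F G + 1) :
    rad ξ K ≤ G := by
  by_contra hle
  have hatom : IsAtom (rad ξ K) := isAtom_iff_finrank_eq_one.2 hK
  have hdisj : Disjoint (rad ξ K) G := (hatom.not_le_iff_disjoint).1 hle
  have hsup : G ⊔ rad ξ K = K := by
    refine eq_of_le_of_finrank_le (sup_le hGK inf_le_left) ?_
    have := finrank_sup_add_finrank_inf_eq G (rad ξ K)
    rw [hdisj.symm.eq_bot, finrank_bot, show finrank F (rad ξ K) = 1 from hK] at this
    omega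
  refine hG (le_bot_iff.1 (hdisj.le_bot.trans' (le_inf (le_inf (inf_le_left.trans hGK) ?_)
    inf_le_left)))
  conv_rhs => rw [← hsup, orthogonal_sup]
  exact le_inf inf_le_right (inf_le_left.trans (hGK.trans
    ((le_orthogonal_comm hrefl).1 inf_le_right)))

theorem isRegular_sup_of_rad_ne (hrefl : ξ.IsRefl) {H K : Submodule F V} (hH : IsTangential ξ H)
    (hK : IsTangential ξ K) (hHK : rad ξ H ≤ K) (hrank : finrank F ↥(H ⊔ K) = finrank F H + 1)
    (hne : rad ξ H ≠ rad ξ K) : IsRegular ξ (H ⊔ K) := by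
  have hatomH : IsAtom (rad ξ H) := isAtom_iff_finrank_eq_one.2 hH
  have hatomK : IsAtom (rad ξ K) := isAtom_iff_finrank_eq_one.2 hK
  refine (Submodule.eq_bot_iff _).2 fun z ⟨hz, hzperp⟩ => ?_
  rw [SetLike.mem_coe, orthogonal_sup] at hzperp
  have hzH : z ∈ H := by
    by_contra hzH
    have hsup : H ⊔ span F {z} = H ⊔ K := eq_of_le_of_finrank_eq
      (sup_le le_sup_left ((span_singleton_le_iff_mem _ _).2 hz))
      (by rw [finrank_sup_span_singleton hzH, hrank])
    have hle : rad ξ H ≤ ξ.orthogonal (H ⊔ K) := by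
      rw [← hsup, orthogonal_sup]
      refine le_inf inf_le_right ((le_orthogonal_comm hrefl).1 ?_)
      exact (span_singleton_le_iff_mem _ _).2 (BilinForm.orthogonal_le inf_le_left hzperp.1)
    exact hne ((hatomK.le_iff_eq hatomH.ne_bot).1
      (le_inf hHK (hle.trans (BilinForm.orthogonal_le le_sup_right))))
  have hzrad : z ∈ rad ξ H := ⟨hzH, hzperp.1⟩
  exact disjoint_def.1 (hatomH.disjoint_of_ne hatomK hne) z hzrad ⟨hHK hzrad, hzperp.2⟩

theorem rad_eq_of_not_joined (hrefl : ξ.IsRefl) (hm : Even m) {G : Submodule F V}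
    (hG : ¬ IsRegular ξ G) (hrank : finrank F G = m) {H K : TR ξ (m + 1)} (hne : H ≠ K)
    (hH : G ≤ H.1) (hK : G ≤ K.1) (h : ¬ Joined ξ (m + 1) H K) : rad ξ H.1 = rad ξ K.1 := by
  have hm1 : ¬ Even (m + 1) := by simpa [Nat.even_add_one] using hm
  have hsup : finrank F ↥(H.1 ⊔ K.1) = m + 2 := by
    have := H.finrank_sup_add_finrank_inf K
    rw [TR.inf_eq hne hrank hH hK, hrank] at this
    omega
  rw [joined_iff_isTR_sup hne, isTR_iff_of_even (hm.add even_two), and_iff_right hsup] at h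
  have htanH := H.2.isTangential hm1
  have hrad : rad ξ H.1 ≤ K.1 :=
    (rad_le_of_not_isRegular hrefl hG htanH hH (by rw [H.finrank_eq, hrank])).trans hK
  exact of_not_not fun hne => h (isRegular_sup_of_rad_ne hrefl htanH (K.2.isTangential hm1) hrad
    (by rw [hsup, H.finrank_eq]) hne)

theorem Joined.rad_ne (hm : Even m) {H K : TR ξ (m + 1)} (h : Joined ξ (m + 1) H K)
    (hne : H ≠ K) : rad ξ H.1 ≠ rad ξ K.1 := by
  intro hrad
  have hm1 : ¬ Even (m + 1) := by simpa [Nat.even_add_one] using hm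
  have hreg : rad ξ (H.1 ⊔ K.1) = ⊥ := (h.isTR_sup hne).isRegular (hm.add even_two)
  have hle := rad_inf_rad_le_rad_sup (ξ := ξ) H.1 K.1
  rw [hreg, ← hrad, inf_idem] at hle
  exact (isAtom_iff_finrank_eq_one.2 (H.2.isTangential hm1)).ne_bot (le_bot_iff.1 hle)

theorem IsTriangle.inf_le {H K D : TR ξ (m + 1)} (h : IsTriangle ξ (m + 1) H K D) :
    H.1 ⊓ K.1 ≤ D.1 := by
  obtain ⟨hHK, hHD, hKD, hX⟩ := id h
  have near {U W : TR ξ (m + 1)} (hUW : U ≠ W) (hJ : Joined ξ (m + 1) U W) :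
      (nearGraph ξ m).Adj U W := ⟨hUW, .inr (hJ.isTR_sup hUW)⟩
  exact (inf_le_or_le_sup_of_near (near h.ne hHK) (near h.ne_left hHD).symm
    (near h.ne_right hKD).symm).resolve_right
      fun hle => hX ⟨⟨_, hHK.isTR_sup h.ne⟩, le_sup_left, le_sup_right, hle⟩

theorem adj_of_tangentialAdj (hrefl : ξ.IsRefl) (hm : Even m) {H K : TR ξ (m + 1)}
    (h : TangentialAdj ξ (m + 1) H K) : Adj ξ (m + 1) H K := by
  obtain ⟨A, B, C, hA, hB, hC, hAB, hBC, hAC, hneAC⟩ := h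
  have hneAB : A ≠ B := fun h => hBC (h ▸ hAC)
  have hneBC : B ≠ C := fun h => hAB (h ▸ hAC)
  have hne := hA.ne
  have hsup := hA.1.isTR_sup hne
  have hrank : finrank F ↥(H.1 ⊓ K.1) = m := finrank_inf_of_near ⟨hne, .inr hsup⟩
  refine adj_iff.2 ⟨hne, (isTR_iff_of_even hm).2 ⟨hrank, ?_⟩, hsup⟩
  by_contra hG
  have hradAB := rad_eq_of_not_joined hrefl hm hG hrank hneAB hA.inf_le hB.inf_le hAB
  have hradBC := rad_eq_of_not_joined hrefl hm hG hrank hneBC hB.inf_le hC.inf_le hBC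
  exact hAC.rad_ne hm hneAC (hradAB.trans hradBC)

theorem IsTR.joined_adjoin (halt : ξ.IsAlt) (hm : Even m) {G : Submodule F V} (hG : IsTR ξ m G)
    {y z : V} (hy : y ∈ ξ.orthogonal G) (hy0 : y ≠ 0) (hz : z ∈ ξ.orthogonal G) (hz0 : z ≠ 0)
    (hyz : ξ y z ≠ 0) :
    Joined ξ (m + 1) (hG.adjoin halt hm hy hy0) (hG.adjoin halt hm hz hz0) :=
  have hadj := (hG.adj_adjoin_iff halt hm hy hy0 hz hz0).2 hyz
  (joined_iff_isTR_sup hadj.1).2 (adj_iff.1 hadj).2.2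

theorem IsTR.not_joined_adjoin (halt : ξ.IsAlt) (hm : Even m) {G : Submodule F V}
    (hG : IsTR ξ m G) {y z : V} (hy : y ∈ ξ.orthogonal G) (hy0 : y ≠ 0)
    (hz : z ∈ ξ.orthogonal G) (hz0 : z ≠ 0) (hyz : ξ y z = 0) (hspan : y ∉ span F {z}) :
    ¬ Joined ξ (m + 1) (hG.adjoin halt hm hy hy0) (hG.adjoin halt hm hz hz0) := by
  intro hJ
  have hne := (hG.adjoin_eq_adjoin_iff halt hm hy hy0 hz hz0).not.2 hspan
  have hinf := TR.inf_eq hne hG.1 (hG.le_adjoin halt hm hy hy0) (hG.le_adjoin halt hm hz hz0)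
  exact (hG.adj_adjoin_iff halt hm hy hy0 hz hz0).1
    (adj_iff.2 ⟨hne, hinf.symm ▸ hG, hJ.isTR_sup hne⟩) hyz

theorem IsTriangle.of_adjoin (halt : ξ.IsAlt) (hm : Even m) {G : Submodule F V} (hG : IsTR ξ m G)
    {e f w p : V} (he : e ∈ ξ.orthogonal G) (he0 : e ≠ 0) (hf : f ∈ ξ.orthogonal G) (hf0 : f ≠ 0)
    (hw : w ∈ ξ.orthogonal G) (hw0 : w ≠ 0) (hp : p ∈ ξ.orthogonal (G ⊔ span F {e, f}))
    (hef : ξ e f ≠ 0) (hew : ξ e w ≠ 0) (hfw : ξ f w ≠ 0) (hwp : ξ w p ≠ 0) :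
    IsTriangle ξ (m + 1) (hG.adjoin halt hm he he0) (hG.adjoin halt hm hf hf0)
      (hG.adjoin halt hm hw hw0) := by
  refine ⟨hG.joined_adjoin halt hm he he0 hf hf0 hef, hG.joined_adjoin halt hm he he0 hw hw0 hew,
    hG.joined_adjoin halt hm hf hf0 hw hw0 hfw, ?_⟩
  rintro ⟨X, heX, hfX, hwX⟩
  have hne := ((hG.adj_adjoin_iff halt hm he he0 hf hf0).2 hef).1
  have hX : G ⊔ span F {e, f} = X.1 := by
    rw [← TR.sup_eq hne X.finrank_eq heX hfX, hG.adjoin_sup_adjoin]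
  exact hwp (hp w (hX ▸ hwX (hG.mem_adjoin halt hm hw hw0)))

theorem exists_apply_eq_of_isRegular (halt : ξ.IsAlt) (hnd : ξ.Nondegenerate)
    {B : Submodule F V} (hB : IsRegular ξ B) (hrank : finrank F B < finrank F V) (s : F) :
    ∃ g ∈ ξ.orthogonal B, ∃ k ∈ ξ.orthogonal B, ξ g k = s := by
  have hbot : ξ.orthogonal B ≠ ⊥ := fun h => by
    have := finrank_add_finrank_orthogonal hnd B
    rw [h, finrank_bot] at this
    omega
  obtain ⟨g, hg, hg0⟩ := exists_mem_ne_zero_of_ne_bot hbot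
  obtain ⟨k, hk, hgk⟩ := ((isRegular_orthogonal_iff halt.isRefl hnd).2 hB).exists_apply_ne_zero
    halt.isRefl hg hg0
  exact ⟨g, hg, (s / ξ g k) • k, smul_mem _ _ hk, by simp [hgk]⟩

variable [Nontrivial Fˣ] (halt : ξ.IsAlt) (hnd : ξ.Nondegenerate)
include halt

omit [FiniteDimensional F V] in
/-- With a scalar `t ∉ {0, 1}` the vectors `e + f + t g`, `e + f + g` and
`e + t f - (t - 1) k` do. -/
theorem exists_path_of_orthogonal_pairs {e f g k : V} (hef : ξ e f ≠ 0) (hgk : ξ g k = ξ e f)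
    (heg : ξ e g = 0) (hek : ξ e k = 0) (hfg : ξ f g = 0) (hfk : ξ f k = 0) :
    ∃ a ∈ span F {e, f, g, k}, ∃ b ∈ span F {e, f, g, k}, ∃ c ∈ span F {e, f, g, k},
      ξ a b = 0 ∧ ξ b c = 0 ∧ ξ a c ≠ 0 ∧
      ∀ w ∈ ({a, b, c} : Set V), ξ e w ≠ 0 ∧ ξ f w ≠ 0 ∧ ∃ p ∈ span F {g, k}, ξ w p ≠ 0 := by
  obtain ⟨t, ht1⟩ := exists_ne (1 : Fˣ)
  have ht : (t : F) - 1 ≠ 0 := sub_ne_zero.2 (Units.val_eq_one.not.2 ht1)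
  have hfe : ξ f e = -ξ e f := (halt.neg_eq e f).symm
  have hkg : ξ k g = -ξ e f := by rw [← halt.neg_eq, hgk]
  have hge : ξ g e = 0 := halt.isRefl _ _ heg
  have hgf : ξ g f = 0 := halt.isRefl _ _ hfg
  have hself (x : V) : ξ x x = 0 := halt x
  have mem {x : V} (hx : x ∈ ({e, f, g, k} : Set V)) : x ∈ span F {e, f, g, k} := subset_span hx
  have hsum : e + f ∈ span F {e, f, g, k} := add_mem (mem (by simp)) (mem (by simp))
  refine ⟨e + f + (t : F) • g, add_mem hsum (smul_mem _ _ (mem (by simp))), e + f + g,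
    add_mem hsum (mem (by simp)), e + (t : F) • f - ((t : F) - 1) • k,
    sub_mem (add_mem (mem (by simp)) (smul_mem _ _ (mem (by simp)))) (smul_mem _ _ (mem (by simp))),
    ?_, ?_, ?_, ?_⟩
  · simp [*]
  · simp [*]
    ring
  · have : ξ (e + f + (t : F) • g) (e + (t : F) • f - ((t : F) - 1) • k) =
        -(((t : F) - 1) ^ 2 * ξ e f) := by
      simp [*]
      ring
    rw [this, neg_ne_zero]
    exact mul_ne_zero (pow_ne_zero 2 ht) hef
  · rintro w (rfl | rfl | rfl)
    · exact ⟨by simp [*], by simp [*], k, subset_span (by simp), by simp [*]⟩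
    · exact ⟨by simp [*], by simp [*], k, subset_span (by simp), by simp [*]⟩
    · exact ⟨by simp [*], by simp [*], g, subset_span (by simp), by simp [*]⟩

include hnd

theorem IsTR.tangentialAdj_adjoin (hm : Even m) (hmn : m + 2 < finrank F V) {G : Submodule F V}
    (hG : IsTR ξ m G) {e f : V} (he : e ∈ ξ.orthogonal G) (he0 : e ≠ 0) (hf : f ∈ ξ.orthogonal G)
    (hf0 : f ≠ 0) (hef : ξ e f ≠ 0) :
    TangentialAdj ξ (m + 1) (hG.adjoin halt hm he he0) (hG.adjoin halt hm hf hf0) := by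
  have hB : IsTR ξ (m + 2) (G ⊔ span F {e, f}) := by
    rw [← hG.adjoin_sup_adjoin halt hm he he0 hf hf0]
    exact (adj_iff.1 ((hG.adj_adjoin_iff halt hm he he0 hf hf0).2 hef)).2.2
  set B := G ⊔ span F {e, f}
  obtain ⟨g, hg, k, hk, hgk⟩ := exists_apply_eq_of_isRegular halt hnd
    (hB.isRegular (hm.add even_two)) (by rwa [hB.1]) (ξ e f)
  have heB : e ∈ B := mem_sup_right (subset_span (by simp))
  have hfB : f ∈ B := mem_sup_right (subset_span (by simp))
  obtain ⟨a, ha, b, hb, c, hc, hab, hbc, hac, hw⟩ := exists_path_of_orthogonal_pairs halt hef hgk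
    (hg e heB) (hk e heB) (hg f hfB) (hk f hfB)
  have hspan : span F {e, f, g, k} ≤ ξ.orthogonal G := by
    have hBG : ξ.orthogonal B ≤ ξ.orthogonal G := BilinForm.orthogonal_le le_sup_left
    simp only [span_le, Set.insert_subset_iff, Set.singleton_subset_iff]
    exact ⟨he, hf, hBG hg, hBG hk⟩
  have hgkB : span F {g, k} ≤ ξ.orthogonal B := by
    simp only [span_le, Set.insert_subset_iff, Set.singleton_subset_iff]
    exact ⟨hg, hk⟩
  have ne_zero {w : V} (h : w ∈ ({a, b, c} : Set V)) : w ≠ 0 := fun h0 =>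
    (hw w h).1 (by rw [h0, map_zero])
  have triangle {w : V} (hwG : w ∈ ξ.orthogonal G) (h : w ∈ ({a, b, c} : Set V)) :=
    have ⟨hew, hfw, p, hp, hwp⟩ := hw w h
    IsTriangle.of_adjoin halt hm hG he he0 hf hf0 hwG (ne_zero h) (hgkB hp) hef hew hfw hwp
  refine ⟨_, _, _, triangle (hspan ha) (.inl rfl), triangle (hspan hb) (.inr (.inl rfl)),
    triangle (hspan hc) (.inr (.inr rfl)), ?_, ?_, ?_, ?_⟩
  · refine hG.not_joined_adjoin halt hm _ _ _ _ hab fun h => ?_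
    obtain ⟨s, rfl⟩ := mem_span_singleton.1 h
    exact hac (by simp [hbc])
  · refine hG.not_joined_adjoin halt hm _ _ _ _ hbc fun h => ?_
    obtain ⟨s, rfl⟩ := mem_span_singleton.1 h
    rw [map_smul, smul_eq_mul, mul_eq_zero, or_iff_left hac] at hab
    exact ne_zero (.inr (.inl rfl)) (by rw [hab, zero_smul])
  · exact hG.joined_adjoin halt hm _ _ _ _ hac
  · exact ((hG.adj_adjoin_iff halt hm _ _ _ _).2 hac).1

theorem tangentialAdj_of_adj (hm : Even m) (hmn : m + 2 < finrank F V) {H K : TR ξ (m + 1)}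
    (h : Adj ξ (m + 1) H K) : TangentialAdj ξ (m + 1) H K := by
  obtain ⟨G, hGHK⟩ : ∃ G, G = H.1 ⊓ K.1 := ⟨_, rfl⟩
  have hG : IsTR ξ m G := hGHK ▸ (adj_iff.1 h).2.1
  obtain ⟨e, he, he0, rfl⟩ := hG.exists_eq_adjoin halt hm (hGHK.trans_le inf_le_left)
  obtain ⟨f, hf, hf0, rfl⟩ := hG.exists_eq_adjoin halt hm (hGHK.trans_le inf_le_right)
  exact hG.tangentialAdj_adjoin halt hnd hm hmn he he0 hf hf0
    ((hG.adj_adjoin_iff halt hm he he0 hf hf0).1 h)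

theorem adj_map_iff_of_preservesIncidence (hmm : Even m ↔ Even m') (hm : m + 2 < finrank F V)
    (hm' : m' + 2 < finrank F V) {h : TR ξ (m + 1) ≃ TR ξ (m' + 1)}
    {f : TR ξ (m + 2) ≃ TR ξ (m' + 2)} (hf : PreservesIncidence h f) (H K : TR ξ (m + 1)) :
    Adj ξ (m' + 1) (h H) (h K) ↔ Adj ξ (m + 1) H K := by
  by_cases he : Even m
  · have {k : ℕ} (hk : Even k) (hkn : k + 2 < finrank F V) {H K : TR ξ (k + 1)} :
        Adj ξ (k + 1) H K ↔ TangentialAdj ξ (k + 1) H K :=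
      ⟨tangentialAdj_of_adj halt hnd hk hkn, adj_of_tangentialAdj halt.isRefl hk⟩
    rw [this he hm, this (hmm.1 he) hm', hf.tangentialAdj_iff]
  · rw [adj_iff_joined_of_even halt hnd (Nat.even_add_one.2 he),
      adj_iff_joined_of_even halt hnd (Nat.even_add_one.2 (hmm.not.1 he)), hf.joined_iff,
      h.injective.ne_iff]

end Joined

/-! ### Collineations as lattice automorphisms -/

section Points

theorem conj_iff {U W : Submodule F V} : Conj ξ U W ↔ W ≤ ξ.orthogonal U :=
  ⟨fun h w hw u hu => h u hu w hw, fun h u hu _ hw => h hw u hu⟩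

theorem le_iff_forall_point_le {A B : Submodule F V} :
    A ≤ B ↔ ∀ p : Sub F V 1, p.1 ≤ A → p.1 ≤ B := by
  simp only [le_iff_atom_le_imp (a := A), isAtom_iff_finrank_eq_one, Subtype.forall]

/-- A lattice automorphism compatible with `⊥`: the action on all subspaces of an automorphism of
`(𝔓, ⊥)`. -/
def PreservesOrthogonal (ξ : BilinForm F V) (Φ : Submodule F V ≃o Submodule F V) : Prop :=
  ∀ U, Φ (ξ.orthogonal U) = ξ.orthogonal (Φ U)

/-- The permutation of the points preserves the conjugacy, with no assumption on lines. -/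
def PreservesPointConj (ξ : BilinForm F V) (σ : Equiv.Perm (Sub F V 1)) : Prop :=
  ∀ p q, Conj ξ (σ p).1 (σ q).1 ↔ Conj ξ p.1 q.1

/-- The subspace spanned by the images of the points of a subspace. -/
def pointsMap (σ : Equiv.Perm (Sub F V 1)) (W : Submodule F V) : Submodule F V :=
  ⨆ p : {p : Sub F V 1 // p.1 ≤ W}, (σ p.1).1

theorem pointsMap_le_iff {σ : Equiv.Perm (Sub F V 1)} {W U : Submodule F V} :
    pointsMap σ W ≤ U ↔ ∀ p : Sub F V 1, p.1 ≤ W → (σ p).1 ≤ U := by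
  rw [pointsMap, iSup_le_iff, Subtype.forall]

variable {σ : Equiv.Perm (Sub F V 1)}

theorem PreservesPointConj.symm (hσ : PreservesPointConj ξ σ) : PreservesPointConj ξ σ.symm :=
  fun p q => by rw [← hσ, σ.apply_symm_apply, σ.apply_symm_apply]

theorem PreservesPointConj.le_orthogonal_pointsMap_iff (hσ : PreservesPointConj ξ σ)
    (hrefl : ξ.IsRefl) {q : Sub F V 1} {W : Submodule F V} :
    (σ q).1 ≤ ξ.orthogonal (pointsMap σ W) ↔ q.1 ≤ ξ.orthogonal W := by
  rw [le_orthogonal_comm hrefl, pointsMap_le_iff, le_orthogonal_comm hrefl,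
    le_iff_forall_point_le (A := W)]
  simp only [← conj_iff, hσ _ _]

variable [FiniteDimensional F V]

/-- The image of `p ≰ W` lies outside `pointsMap σ W` because `W = W^⊥⊥` is an intersection of
hyperplanes `r^⊥`. -/
theorem PreservesPointConj.le_pointsMap_iff (hσ : PreservesPointConj ξ σ) (hrefl : ξ.IsRefl)
    (hnd : ξ.Nondegenerate) {p : Sub F V 1} {W : Submodule F V} :
    (σ p).1 ≤ pointsMap σ W ↔ p.1 ≤ W := by
  refine ⟨fun h => ?_, fun h => pointsMap_le_iff.1 le_rfl p h⟩
  rw [← BilinForm.orthogonal_orthogonal hnd hrefl W, le_orthogonal_comm hrefl,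
    le_iff_forall_point_le]
  intro r hr
  rw [← conj_iff, ← hσ, conj_iff, ← le_orthogonal_comm hrefl]
  exact h.trans ((le_orthogonal_comm hrefl).1 ((hσ.le_orthogonal_pointsMap_iff hrefl).2 hr))

theorem PreservesPointConj.pointsMap_symm_pointsMap (hσ : PreservesPointConj ξ σ)
    (hrefl : ξ.IsRefl) (hnd : ξ.Nondegenerate) (W : Submodule F V) :
    pointsMap σ.symm (pointsMap σ W) = W := by
  refine le_antisymm (pointsMap_le_iff.2 fun p hp => ?_) (le_iff_forall_point_le.2 fun p hp => ?_)
  · rwa [← hσ.le_pointsMap_iff hrefl hnd, σ.apply_symm_apply]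
  · rwa [← σ.symm_apply_apply p, hσ.symm.le_pointsMap_iff hrefl hnd,
      hσ.le_pointsMap_iff hrefl hnd]

/-- The lattice automorphism extending a permutation of the points which preserves `⊥`. -/
def PreservesPointConj.orderIso (hσ : PreservesPointConj ξ σ) (hrefl : ξ.IsRefl)
    (hnd : ξ.Nondegenerate) : Submodule F V ≃o Submodule F V where
  toFun := pointsMap σ
  invFun := pointsMap σ.symm
  left_inv := hσ.pointsMap_symm_pointsMap hrefl hnd
  right_inv := hσ.symm.pointsMap_symm_pointsMap hrefl hnd
  map_rel_iff' {A B} := by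
    simp only [Equiv.coe_fn_mk, pointsMap_le_iff, hσ.le_pointsMap_iff hrefl hnd]
    exact le_iff_forall_point_le.symm

theorem PreservesPointConj.orderIso_point (hσ : PreservesPointConj ξ σ) (hrefl : ξ.IsRefl)
    (hnd : ξ.Nondegenerate) (p : Sub F V 1) : hσ.orderIso hrefl hnd p.1 = (σ p).1 := by
  refine le_antisymm (pointsMap_le_iff.2 fun q hq => ?_)
    ((hσ.le_pointsMap_iff hrefl hnd).2 le_rfl)
  rw [show q = p from Subtype.ext (eq_of_le_of_finrank_eq hq (by rw [p.2, q.2]))]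

theorem PreservesPointConj.preservesOrthogonal (hσ : PreservesPointConj ξ σ) (hrefl : ξ.IsRefl)
    (hnd : ξ.Nondegenerate) : PreservesOrthogonal ξ (hσ.orderIso hrefl hnd) := by
  intro U
  refine le_antisymm (pointsMap_le_iff.2 fun q => (hσ.le_orthogonal_pointsMap_iff hrefl).2)
    (le_iff_forall_point_le.2 fun q hq => ?_)
  rw [← σ.apply_symm_apply q] at hq ⊢
  exact (hσ.le_pointsMap_iff hrefl hnd).2 ((hσ.le_orthogonal_pointsMap_iff hrefl).1 hq)

end Points

section OrderIso

theorem finrank_orderIso [FiniteDimensional F V] (Φ : Submodule F V ≃o Submodule F V)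
    (U : Submodule F V) : finrank F (Φ U) = finrank F U := by
  have h : Module.length F (Φ U) = Module.length F U := by
    rw [Module.length_submodule, Module.length_submodule, Order.height_orderIso]
  rw [Module.length_eq_finrank, Module.length_eq_finrank] at h
  exact_mod_cast h

variable {Φ : Submodule F V ≃o Submodule F V}

theorem PreservesOrthogonal.symm (hΦ : PreservesOrthogonal ξ Φ) :
    PreservesOrthogonal ξ Φ.symm := fun U => by
  rw [OrderIso.symm_apply_eq, hΦ, Φ.apply_symm_apply]

theorem PreservesOrthogonal.rad_apply (hΦ : PreservesOrthogonal ξ Φ) (U : Submodule F V) :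
    rad ξ (Φ U) = Φ (rad ξ U) := by
  rw [rad, rad, Φ.map_inf, hΦ]

variable [FiniteDimensional F V]

theorem PreservesOrthogonal.isTR_iff (hΦ : PreservesOrthogonal ξ Φ) {k : ℕ} {U : Submodule F V} :
    IsTR ξ k (Φ U) ↔ IsTR ξ k U := by
  rw [IsTR, IsTR, IsRegular, IsTangential, hΦ.rad_apply, finrank_orderIso, finrank_orderIso,
    map_eq_bot_iff, IsRegular, IsTangential]

/-- The bijection of `(T-R)_k` given by a lattice automorphism compatible with `⊥`. -/
def PreservesOrthogonal.permTR (hΦ : PreservesOrthogonal ξ Φ) (k : ℕ) : Equiv.Perm (TR ξ k) :=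
  Φ.toEquiv.subtypeEquiv fun _ => hΦ.isTR_iff.symm

theorem PreservesOrthogonal.image_pencil (hΦ : PreservesOrthogonal ξ Φ) (k : ℕ)
    (H B : Submodule F V) : hΦ.permTR k '' pencil ξ k H B = pencil ξ k (Φ H) (Φ B) := by
  ext U
  rw [Equiv.image_eq_preimage_symm]
  exact and_congr Φ.le_symm_apply Φ.symm_apply_le

theorem PreservesOrthogonal.image_mem_pencils (hΦ : PreservesOrthogonal ξ Φ) {k : ℕ}
    {g : Set (TR ξ k)} (hg : g ∈ pencils ξ k) : hΦ.permTR k '' g ∈ pencils ξ k := by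
  obtain ⟨hne, H, B, hH, hB, hHB, rfl⟩ := hg
  exact ⟨hne.image _, Φ H, Φ B, hΦ.isTR_iff.2 hH, hΦ.isTR_iff.2 hB, Φ.le_iff_le.2 hHB,
    hΦ.image_pencil k H B⟩

theorem PreservesOrthogonal.permTR_mem_grassmannAutomorphisms (hΦ : PreservesOrthogonal ξ Φ)
    (k : ℕ) : hΦ.permTR k ∈ grassmannAutomorphisms ξ k := by
  refine fun g => ⟨fun h => ?_, hΦ.image_mem_pencils⟩
  have key : hΦ.symm.permTR k '' (hΦ.permTR k '' g) = g := (hΦ.permTR k).symm_image_image g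
  exact key ▸ hΦ.symm.image_mem_pencils h

/-- The collineation given by a lattice automorphism. -/
def collineationOfOrderIso (Φ : Submodule F V ≃o Submodule F V) : Collineation F V where
  onPoints := Φ.toEquiv.subtypeEquiv fun U => by rw [← finrank_orderIso Φ U]; rfl
  onLines := Φ.toEquiv.subtypeEquiv fun U => by rw [← finrank_orderIso Φ U]; rfl
  incidence _ _ := Φ.le_iff_le

theorem collineationOfOrderIso_maps (Φ : Submodule F V ≃o Submodule F V) (U : Submodule F V) :
    (collineationOfOrderIso Φ).Maps U (Φ U) :=
  fun _ => Φ.le_iff_le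

theorem PreservesOrthogonal.preservesConj (hΦ : PreservesOrthogonal ξ Φ) :
    (collineationOfOrderIso Φ).PreservesConj ξ := fun p q => by
  rw [conj_iff, conj_iff, ← Φ.le_iff_le (x := q.1), hΦ]
  rfl

end OrderIso

section Induced

variable [FiniteDimensional F V]

theorem Collineation.exists_orderIso (hrefl : ξ.IsRefl) (hnd : ξ.Nondegenerate)
    {φ : Collineation F V} (hφ : φ.PreservesConj ξ) :
    ∃ Φ : Submodule F V ≃o Submodule F V, PreservesOrthogonal ξ Φ ∧
      ∀ U W, φ.Maps U W ↔ W = Φ U := by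
  have hσ : PreservesPointConj ξ φ.onPoints := hφ
  set Φ := hσ.orderIso hrefl hnd
  have hpoint (p : Sub F V 1) : Φ p.1 = (φ.onPoints p).1 := hσ.orderIso_point hrefl hnd p
  refine ⟨Φ, hσ.preservesOrthogonal hrefl hnd, fun U W => ⟨fun h => ?_, ?_⟩⟩
  · have key (q : Sub F V 1) : q.1 ≤ W ↔ q.1 ≤ Φ U := by
      obtain ⟨p, rfl⟩ := φ.onPoints.surjective q
      rw [h p, ← hpoint, Φ.le_iff_le]
    exact le_antisymm (le_iff_forall_point_le.2 fun q => (key q).1)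
      (le_iff_forall_point_le.2 fun q => (key q).2)
  · rintro rfl p
    rw [← hpoint, Φ.le_iff_le]

theorem mem_inducedBijections (hrefl : ξ.IsRefl) (hnd : ξ.Nondegenerate) {k : ℕ}
    {f : Equiv.Perm (TR ξ k)} :
    f ∈ inducedBijections ξ k ↔ ∃ Φ : Submodule F V ≃o Submodule F V,
      PreservesOrthogonal ξ Φ ∧ ∀ U : TR ξ k, (f U).1 = Φ U.1 := by
  constructor
  · rintro ⟨φ, hφ, hf⟩
    obtain ⟨Φ, hΦ, hmaps⟩ := φ.exists_orderIso hrefl hnd hφ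
    exact ⟨Φ, hΦ, fun U => (hmaps _ _).1 (hf U)⟩
  · rintro ⟨Φ, hΦ, hf⟩
    exact ⟨_, hΦ.preservesConj, fun U => hf U ▸ collineationOfOrderIso_maps Φ U.1⟩

theorem inducedBijections_subset_grassmannAutomorphisms (hrefl : ξ.IsRefl)
    (hnd : ξ.Nondegenerate) (k : ℕ) : inducedBijections ξ k ⊆ grassmannAutomorphisms ξ k := by
  intro f hf
  obtain ⟨Φ, hΦ, h⟩ := (mem_inducedBijections hrefl hnd).1 hf
  have hfΦ : f = hΦ.permTR k := Equiv.ext fun U => Subtype.ext (h U)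
  exact hfΦ ▸ hΦ.permTR_mem_grassmannAutomorphisms k

omit [FiniteDimensional F V] in
theorem grassmannAutomorphisms_subset_adjacencyBijections (k : ℕ) :
    grassmannAutomorphisms ξ k ⊆ adjacencyBijections ξ k := by
  intro f hf U W
  refine and_congr f.injective.ne_iff ⟨?_, ?_⟩
  · rintro ⟨g, hg, hU, hW⟩
    exact ⟨f ⁻¹' g, (hf _).1 (by rwa [f.image_preimage]), hU, hW⟩
  · rintro ⟨g, hg, hU, hW⟩
    exact ⟨f '' g, (hf g).2 hg, ⟨U, hU, rfl⟩, ⟨W, hW, rfl⟩⟩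

theorem Collineation.PreservesConj.existsUnique_maps (hrefl : ξ.IsRefl) (hnd : ξ.Nondegenerate)
    (k : ℕ) {φ : Collineation F V} (hφ : φ.PreservesConj ξ) :
    ∃! f : Equiv.Perm (TR ξ k), ∀ U : TR ξ k, φ.Maps U.1 (f U).1 := by
  obtain ⟨Φ, hΦ, hmaps⟩ := φ.exists_orderIso hrefl hnd hφ
  refine ⟨hΦ.permTR k, fun U => (hmaps _ _).2 rfl, fun f hf => ?_⟩
  exact Equiv.ext fun U => Subtype.ext ((hmaps _ _).1 (hf U))

omit [FiniteDimensional F V] in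
theorem isTR_zero_bot : IsTR ξ 0 (⊥ : Submodule F V) :=
  (isTR_iff_of_even Even.zero).2 ⟨finrank_bot F V, isRegular_bot⟩

theorem isTR_one_iff (halt : ξ.IsAlt) {U : Submodule F V} : IsTR ξ 1 U ↔ finrank F U = 1 :=
  ⟨fun h => h.1, fun h => isTR_zero_bot.succ_of_le halt Even.zero bot_le h⟩

theorem adj_one_iff (halt : ξ.IsAlt) {X Y : TR ξ 1} : Adj ξ 1 X Y ↔ ¬ Conj ξ X.1 Y.1 := by
  have hbot : IsTR ξ 0 (⊥ : Submodule F V) := isTR_zero_bot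
  obtain ⟨x, hx, hx0, rfl⟩ := hbot.exists_eq_adjoin halt Even.zero (X := X) bot_le
  obtain ⟨y, hy, hy0, rfl⟩ := hbot.exists_eq_adjoin halt Even.zero (X := Y) bot_le
  rw [show Adj ξ 1 _ _ ↔ _ from hbot.adj_adjoin_iff halt Even.zero hx hx0 hy hy0, not_iff_not,
    conj_iff, hbot.adjoin_le_iff halt Even.zero hy hy0 bot_le]
  change _ ↔ y ∈ ξ.orthogonal (⊥ ⊔ span F {x})
  rw [bot_sup_eq, mem_orthogonal_span_singleton_iff]

theorem adjacencyBijections_one_subset_inducedBijections (halt : ξ.IsAlt)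
    (hnd : ξ.Nondegenerate) : adjacencyBijections ξ 1 ⊆ inducedBijections ξ 1 := by
  intro f hf
  let e : TR ξ 1 ≃ Sub F V 1 := Equiv.subtypeEquivRight fun _ => isTR_one_iff halt
  have hσ : PreservesPointConj ξ ((e.symm.trans f).trans e) := fun p q => by
    have := hf (e.symm p) (e.symm q)
    rwa [adj_one_iff halt, adj_one_iff halt, not_iff_not] at this
  exact (mem_inducedBijections halt.isRefl hnd).2 ⟨_, hσ.preservesOrthogonal halt.isRefl hnd,
    fun U => (hσ.orderIso_point halt.isRefl hnd (e U)).symm⟩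

end Induced

/-! ### Isomorphisms of Grassmann graphs -/

section MapsTops

/-- The map takes the top of each element of `(T-R)_{m+2}` to a top. -/
def MapsTops (f : TR ξ (m + 1) → TR ξ (m' + 1)) : Prop :=
  ∀ B, IsTR ξ (m + 2) B → IsTop (f '' top ξ m B)

/-- The map takes the star of each element of `(T-R)_m` to a star. -/
def MapsStars (f : TR ξ (m + 1) → TR ξ (m' + 1)) : Prop :=
  ∀ H, IsTR ξ m H → IsStar (f '' star ξ m H)

theorem PreservesIncidence.mapsTops {h : TR ξ (m + 1) ≃ TR ξ (m' + 1)}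
    {f : TR ξ (m + 2) ≃ TR ξ (m' + 2)} (hf : PreservesIncidence h f) : MapsTops h := by
  refine fun B hB => ⟨(f ⟨B, hB⟩).1, (f ⟨B, hB⟩).2, ?_⟩
  rw [h.image_eq_preimage_symm]
  ext K
  obtain ⟨H, rfl⟩ := h.surjective K
  rw [Set.mem_preimage, h.symm_apply_apply]
  exact (hf H ⟨B, hB⟩).symm

variable [FiniteDimensional F V]

theorem exists_preservesIncidence (halt : ξ.IsAlt) (hnd : ξ.Nondegenerate)
    (hm : m + 2 < finrank F V) (hm' : m' + 2 < finrank F V) {f : TR ξ (m + 1) ≃ TR ξ (m' + 1)}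
    (hf : MapsStars f) (hf' : MapsStars f.symm) :
    ∃ h : TR ξ m ≃ TR ξ m', PreservesIncidence h f := by
  choose g hg hfg using hf
  choose g' hg' hfg' using hf'
  refine ⟨⟨fun H => ⟨g H.1 H.2, hg _ _⟩, fun H => ⟨g' H.1 H.2, hg' _ _⟩, fun H => ?_, fun H => ?_⟩,
    fun H X => ?_⟩
  · refine Subtype.ext (star_injective halt hnd hm (hg' _ _) H.2 ?_)
    rw [← hfg', ← hfg, f.symm_image_image]
  · refine Subtype.ext (star_injective halt hnd hm' (hg _ _) H.2 ?_)
    rw [← hfg, ← hfg', f.image_symm_image]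
  · change f X ∈ star ξ m' (g H.1 H.2) ↔ X ∈ star ξ m H.1
    rw [← hfg, f.injective.mem_set_image]

theorem PreservesIncidence.apply_eq_of_le (halt : ξ.IsAlt) (hnd : ξ.Nondegenerate)
    {h : TR ξ (m + 1) ≃ TR ξ (m + 1)} {f : TR ξ (m + 2) ≃ TR ξ (m + 2)}
    (hf : PreservesIncidence h f) {Φ : Submodule F V ≃o Submodule F V}
    (hΦ : ∀ H, (h H).1 = Φ H.1) (U : TR ξ (m + 2)) : (f U).1 = Φ U.1 := by
  obtain ⟨H, hH⟩ := U.2.exists_le halt hnd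
  obtain ⟨G, hG⟩ := H.2.exists_le halt hnd
  obtain ⟨W, hne, -, hW⟩ := exists_ne_mem_star_inter_top halt hnd G.2 U.2 hG hH
  refine (eq_of_le_of_finrank_eq ?_ (by rw [finrank_orderIso, U.finrank_eq, (f U).finrank_eq])).symm
  rw [← TR.sup_eq hne U.2.1 hH hW, Φ.map_sup, ← hΦ, ← hΦ]
  exact sup_le ((hf _ _).2 hH) ((hf _ _).2 hW)

variable [Nontrivial Fˣ] (halt : ξ.IsAlt) (hnd : ξ.Nondegenerate)
include halt hnd

theorem MapsTops.mapsStars (hm1 : 1 ≤ m) (hm : m + 2 < finrank F V)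
    {f : grassmannGraph ξ (m + 1) ≃g grassmannGraph ξ (m' + 1)} (hf : MapsTops f) :
    MapsStars f := by
  intro H hH
  obtain ⟨X, hX⟩ := hH.exists_ge halt hnd (by omega)
  obtain ⟨B, hB⟩ := X.2.exists_ge halt hnd (by omega)
  exact (isStar_image_star_iff_isTop_image_top halt hnd hm1 hm f hH B.2 hX hB).2 (hf _ B.2)

theorem MapsTops.mapsStars_symm (hm' : m' + 2 < finrank F V)
    {f : grassmannGraph ξ (m + 1) ≃g grassmannGraph ξ (m' + 1)} (hf : MapsTops f) :
    MapsStars f.symm := by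
  intro H' hH'
  refine ((isBlock_star halt hnd hm' hH').image halt hnd f.symm).isStar_or_isTop.resolve_right ?_
  rintro ⟨B, hB, hsymm⟩
  obtain ⟨B', hB', h⟩ := hf B hB
  refine star_ne_top halt hnd hm' hH' hB'.1 ?_
  rw [← h, ← hsymm]
  exact (f.toEquiv.image_symm_image _).symm

theorem isStar_image_star_of_joined (hm1 : 1 ≤ m) (hm : m + 2 < finrank F V)
    (f : grassmannGraph ξ (m + 1) ≃g grassmannGraph ξ (m' + 1)) {H K : TR ξ m}
    (hHK : Joined ξ m H K) (hH : IsStar (f '' star ξ m H.1)) : IsStar (f '' star ξ m K.1) := by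
  obtain ⟨X, hHX, hKX⟩ := hHK
  obtain ⟨B, hB⟩ := X.2.exists_ge halt hnd (by omega)
  rw [isStar_image_star_iff_isTop_image_top halt hnd hm1 hm f H.2 B.2 hHX hB] at hH
  rwa [isStar_image_star_iff_isTop_image_top halt hnd hm1 hm f K.2 B.2 hKX hB]

theorem mapsTops_or_forall_isStar_image_top (hm1 : 1 ≤ m) (hm : m + 2 < finrank F V)
    (f : grassmannGraph ξ (m + 1) ≃g grassmannGraph ξ (m' + 1)) :
    MapsTops f ∨ ∀ B, IsTR ξ (m + 2) B → IsStar (f '' top ξ m B) := by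
  have iff_of_le (B : TR ξ (m + 2)) :
      ∃ H : TR ξ m, IsStar (f '' star ξ m H.1) ↔ IsTop (f '' top ξ m B.1) := by
    obtain ⟨X, hX⟩ := B.2.exists_le halt hnd
    obtain ⟨H, hH⟩ := X.2.exists_le halt hnd
    exact ⟨H, isStar_image_star_iff_isTop_image_top halt hnd hm1 hm f H.2 B.2 hH hX⟩
  by_cases h : ∃ H : TR ξ m, IsStar (f '' star ξ m H.1)
  · left
    intro B hB
    obtain ⟨H₀, hH₀⟩ := h
    have hstar (H : TR ξ m) : IsStar (f '' star ξ m H.1) := by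
      induction reflTransGen_joined halt hnd (by omega) H₀ H with
      | refl => exact hH₀
      | tail _ hHK ih => exact isStar_image_star_of_joined halt hnd hm1 hm f hHK ih
    obtain ⟨H, hH⟩ := iff_of_le ⟨B, hB⟩
    exact hH.1 (hstar H)
  · right
    intro B hB
    obtain ⟨H, hH⟩ := iff_of_le ⟨B, hB⟩
    exact ((isBlock_top halt hnd hm1 hB).image halt hnd f).isStar_or_isTop.resolve_right
      fun hB => h ⟨H, hH.2 hB⟩

end MapsTops

section Descent

variable [FiniteDimensional F V] [Nontrivial Fˣ] (halt : ξ.IsAlt) (hnd : ξ.Nondegenerate)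
include halt hnd

/-- All points are near, so otherwise every star would be everything, and every top as well. -/
theorem eq_zero_of_grassmannGraph_one_iso (hm : m + 2 < finrank F V)
    (f : grassmannGraph ξ (0 + 1) ≃g grassmannGraph ξ (m + 1)) : m = 0 := by
  by_contra h0
  have hnear (X Y : TR ξ (m + 1)) (hne : X ≠ Y) : (nearGraph ξ m).Adj X Y := by
    rw [← (nearIso halt hnd f).symm.map_adj_iff]
    have hne' := (nearIso halt hnd f).symm.injective.ne hne
    have hinf := finrank_eq_zero.1 (Nat.le_zero.1 (TR.finrank_inf_le hne'))
    exact ⟨hne', .inl (hinf ▸ isTR_zero_bot)⟩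
  obtain ⟨X⟩ : Nonempty (TR ξ (m + 1)) := by
    obtain ⟨X, -⟩ := isTR_zero_bot.exists_ge (ξ := ξ) halt hnd (by omega)
    exact ⟨f X⟩
  obtain ⟨H, -⟩ := X.2.exists_le halt hnd
  obtain ⟨B, -⟩ := X.2.exists_ge halt hnd (by omega)
  have eq_univ {C : Set (TR ξ (m + 1))} (hC : IsBlock C) : C = Set.univ :=
    Set.eq_univ_of_forall fun Z => (maximal_isClique_iff.1 hC.1).2 Z fun X _ => hnear Z X
  refine star_ne_top halt hnd hm H.2 B.2.1 ?_
  rw [eq_univ (isBlock_star halt hnd hm H.2),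
    eq_univ (isBlock_top halt hnd (Nat.one_le_iff_ne_zero.2 h0) B.2)]

/-- The isomorphism induced on `(T-R)_{m+1}` by one of `(T-R)_{m+2}`. -/
def PreservesIncidence.iso (hmm : Even m ↔ Even m') (hm : m + 2 < finrank F V)
    (hm' : m' + 2 < finrank F V) {h : TR ξ (m + 1) ≃ TR ξ (m' + 1)}
    {f : TR ξ (m + 2) ≃ TR ξ (m' + 2)} (hf : PreservesIncidence h f) :
    grassmannGraph ξ (m + 1) ≃g grassmannGraph ξ (m' + 1) where
  toEquiv := h
  map_rel_iff' := adj_map_iff_of_preservesIncidence halt hnd hmm hm hm' hf _ _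

theorem MapsTops.exists_orderIso (hmm : Even m ↔ Even m') (hm : m + 2 < finrank F V)
    (hm' : m' + 2 < finrank F V) {f : grassmannGraph ξ (m + 1) ≃g grassmannGraph ξ (m' + 1)}
    (hf : MapsTops f) :
    m = m' ∧ ∃ Φ : Submodule F V ≃o Submodule F V,
      PreservesOrthogonal ξ Φ ∧ ∀ U : TR ξ (m + 1), (f U).1 = Φ U.1 := by
  induction m generalizing m' with
  | zero =>
    obtain rfl := eq_zero_of_grassmannGraph_one_iso halt hnd hm' f
    exact ⟨rfl, (mem_inducedBijections halt.isRefl hnd).1 <|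
      adjacencyBijections_one_subset_inducedBijections halt hnd (a := f.toEquiv)
        fun _ _ => f.map_adj_iff⟩
  | succ l ih =>
    obtain _ | l' := m'
    · exact absurd (eq_zero_of_grassmannGraph_one_iso halt hnd hm f.symm) l.succ_ne_zero
    obtain ⟨h, hh⟩ := exists_preservesIncidence halt hnd hm hm' (f := f.toEquiv)
      (hf.mapsStars halt hnd l.succ_pos hm) (hf.mapsStars_symm halt hnd hm')
    have hll : Even l ↔ Even l' := by
      rwa [Nat.even_add_one, Nat.even_add_one, not_iff_not] at hmm
    obtain ⟨rfl, Φ, hΦ, hhΦ⟩ := ih hll (by omega) (by omega)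
      (f := hh.iso halt hnd hll (by omega) (by omega)) hh.mapsTops
    exact ⟨rfl, Φ, hΦ, hh.apply_eq_of_le halt hnd hhΦ⟩

omit [Nontrivial Fˣ] in
theorem adjacencyBijections_subset_inducedBijections_of_add_one (h : (m + 1) + 1 = finrank F V) :
    adjacencyBijections ξ (m + 1) ⊆ inducedBijections ξ (m + 1) := by
  intro f hf
  let D : grassmannGraph ξ (m + 1) ≃g grassmannGraph ξ (0 + 1) := orthogonalIso halt hnd h
  let f' : grassmannGraph ξ (m + 1) ≃g grassmannGraph ξ (m + 1) := ⟨f, hf _ _⟩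
  have hg : (D.symm.trans (f'.trans D)).toEquiv ∈ adjacencyBijections ξ 1 := fun X Y =>
    (D.symm.trans (f'.trans D)).map_rel_iff
  obtain ⟨Φ, hΦ, hgΦ⟩ := (mem_inducedBijections halt.isRefl hnd).1
    (adjacencyBijections_one_subset_inducedBijections halt hnd hg)
  refine (mem_inducedBijections halt.isRefl hnd).2 ⟨Φ, hΦ, fun U => ?_⟩
  have hU : ξ.orthogonal (f U).1 = Φ (ξ.orthogonal U.1) := by
    rw [show Φ (ξ.orthogonal U.1) = (D (f (D.symm (D U)))).1 from (hgΦ (D U)).symm,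
      D.symm_apply_apply]
    rfl
  rw [← BilinForm.orthogonal_orthogonal hnd halt.isRefl (f U).1, hU, hΦ,
    BilinForm.orthogonal_orthogonal hnd halt.isRefl]

/-- If `f` exchanges stars and tops then `U ↦ f(U)^⊥` takes tops to tops. -/
theorem mem_dualInducedBijections_of_forall_isStar_image_top (hm0 : 0 < m)
    (hm : m + 2 < finrank F V) (f : grassmannGraph ξ (m + 1) ≃g grassmannGraph ξ (m + 1))
    (hf : ∀ B, IsTR ξ (m + 2) B → IsStar (f '' top ξ m B)) :
    2 * (m + 1) = finrank F V ∧ f.toEquiv ∈ dualInducedBijections ξ (m + 1) := by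
  obtain ⟨m', hm'⟩ : ∃ m', (m + 1) + (m' + 1) = finrank F V := ⟨finrank F V - (m + 2), by omega⟩
  let D := orthogonalIso halt hnd hm'
  have hmm : Even m ↔ Even m' := by
    have := even_finrank halt hnd
    rw [← hm'] at this
    simpa only [Nat.even_add, Nat.not_even_one, iff_false, not_iff_not] using this
  have htops : MapsTops (f.trans D) := fun B hB => by
    obtain ⟨H, hH, h⟩ := hf B hB
    refine ⟨ξ.orthogonal H, (isTR_orthogonal_iff halt hnd (by omega)).2 hH, ?_⟩
    rw [← image_orthogonalIso_star halt hnd hm', ← h, ← Set.image_comp]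
    rfl
  obtain ⟨rfl, Φ, hΦ, hDΦ⟩ := htops.exists_orderIso halt hnd hmm hm (by omega)
  refine ⟨by omega, _, hΦ.preservesConj, fun U => ?_⟩
  have hU : ξ.orthogonal (f U).1 = Φ U.1 := hDΦ U
  rw [show (f.toEquiv U).1 = Φ (ξ.orthogonal U.1) by
    rw [hΦ, ← hU, BilinForm.orthogonal_orthogonal hnd halt.isRefl]; rfl]
  exact collineationOfOrderIso_maps Φ _

theorem mem_inducedBijections_or_mem_dualInducedBijections (hm : m + 2 ≤ finrank F V)
    {f : Equiv.Perm (TR ξ (m + 1))} (hf : f ∈ adjacencyBijections ξ (m + 1)) :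
    f ∈ inducedBijections ξ (m + 1) ∨
      (2 * (m + 1) = finrank F V ∧ f ∈ dualInducedBijections ξ (m + 1)) := by
  rcases hm.eq_or_lt with hm | hm
  · exact .inl (adjacencyBijections_subset_inducedBijections_of_add_one halt hnd hm hf)
  obtain rfl | hm0 := Nat.eq_zero_or_pos m
  · exact .inl (adjacencyBijections_one_subset_inducedBijections halt hnd hf)
  let f' : grassmannGraph ξ (m + 1) ≃g grassmannGraph ξ (m + 1) := ⟨f, hf _ _⟩
  rcases mapsTops_or_forall_isStar_image_top halt hnd hm0 hm f' with htop | hstar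
  · exact .inl ((mem_inducedBijections halt.isRefl hnd).2
      (htop.exists_orderIso halt hnd .rfl hm hm).2)
  · exact .inr (mem_dualInducedBijections_of_forall_isStar_image_top halt hnd hm0 hm f' hstar)

end Descent

end SymplecticGrassmann

theorem corollary3_general {F V : Type*} [Field F] [AddCommGroup V] [Module F V]
    [FiniteDimensional F V] [Nontrivial Fˣ]
    (ξ : LinearMap.BilinForm F V) (halt : ξ.IsAlt) (hnd : ξ.Nondegenerate)
    (n k : ℕ) (hn : Module.finrank F V = n) (hk : 1 ≤ k) (hkn : k ≤ n - 1) :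
    (k ≠ n - k →
      grassmannAutomorphisms ξ k = adjacencyBijections ξ k ∧
      adjacencyBijections ξ k = inducedBijections ξ k ∧
      (∀ φ : Collineation F V, φ.PreservesConj ξ →
        ∃! f : Equiv.Perm (TR ξ k), ∀ U : TR ξ k, φ.Maps U.1 (f U).1)) ∧
    (k = n - k →
      adjacencyBijections ξ k ⊆ inducedBijections ξ k ∪ dualInducedBijections ξ k) := by
  obtain ⟨m, rfl⟩ : ∃ m, k = m + 1 := ⟨k - 1, by omega⟩
  have induced_or_dual (f) (hf : f ∈ adjacencyBijections ξ (m + 1)) :=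
    mem_inducedBijections_or_mem_dualInducedBijections halt hnd (by omega) hf
  refine ⟨fun hne => ?_, fun _ f hf => (induced_or_dual f hf).imp_right And.right⟩
  have adj_induced : adjacencyBijections ξ (m + 1) ⊆ inducedBijections ξ (m + 1) := fun f hf =>
    (induced_or_dual f hf).resolve_right fun h => hne (by omega)
  have induced_aut := inducedBijections_subset_grassmannAutomorphisms halt.isRefl hnd (m + 1)
  have aut_adj := grassmannAutomorphisms_subset_adjacencyBijections (ξ := ξ) (m + 1)
  exact ⟨aut_adj.antisymm (adj_induced.trans induced_aut),
    adj_induced.antisymm (induced_aut.trans aut_adj),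
    fun φ hφ => hφ.existsUnique_maps halt.isRefl hnd (m + 1)⟩

theorem corollary3 {F V : Type*} [Field F] [AddCommGroup V] [Module F V]
    [FiniteDimensional F V] (hF : ringChar F ≠ 2)
    (ξ : LinearMap.BilinForm F V) (halt : ξ.IsAlt) (hnd : ξ.Nondegenerate)
    (n k : ℕ) (hn : Module.finrank F V = n) (hk : 1 ≤ k) (hkn : k ≤ n - 1) :
    (k ≠ n - k →
      grassmannAutomorphisms ξ k = adjacencyBijections ξ k ∧
      adjacencyBijections ξ k = inducedBijections ξ k ∧
      (∀ φ : Collineation F V, φ.PreservesConj ξ →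
        ∃! f : Equiv.Perm (TR ξ k), ∀ U : TR ξ k, φ.Maps U.1 (f U).1)) ∧
    (k = n - k →
      adjacencyBijections ξ k ⊆ inducedBijections ξ k ∪ dualInducedBijections ξ k) := by
  have : Nontrivial Fˣ :=
    ⟨-1, 1, fun h => Ring.neg_one_ne_one_of_char_ne_two hF (by simpa using congrArg Units.val h)⟩
  exact corollary3_general ξ halt hnd n k hn hk hkn
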